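/- Let $k$ be a field and $H$ a Hopf algebra over $k$ with bijective antipode. Let $R=\bigoplus_{n\ge 0}R(n)$ be an $\mathbb{N}_0$-graded Hopf algebra in the braided category ${}^H_H\mathcal{YD}$ of left Yetter-Drinfeld modules over $H$, with all $R(n)$ finite-dimensional. Let $R\#H$ be its bosonization (smash product algebra and cosmash product coalgebra), graded by $\deg (R(n)\#H)=n$, and let $\vartheta:R\#H\to R$, $r\#h\mapsto r\,\varepsilon(h)$. Let $W=\bigoplus_{i\in\mathbb{Z}}W(i)$ be an irreducible object in the category of $\mathbb{Z}$-graded left Yetter-Drinfeld modules over $R\#H$ (that is, $W\ne 0$ and $W$ has no graded Yetter-Drinfeld submodules besides $0$ and $W$), where graded means that action and coaction have degree $0$. Assume that $W$ is locally finite as an $R$-module, that is, every element of $W$ lies in a finite-dimensional $R$-submodule (for instance, $\dim W<\infty$). Write $\delta^R_W=(\vartheta\otimes\mathrm{id})\delta_W:W\to R\otimes W$ and, for $n\ge 0$, $$\mathcal{F}^\delta_nW=\Big\{w\in W \;\Big|\; \delta^R_W(w)\in \bigoplus_{i=0}^nR(i)\otimes W\Big\},\qquad \mathcal{F}^\mu_nW=\{w\in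 W \mid R(i)w=0 \text{ for all } i>n\}.$$ Then there are integers $n_0\le n_1$ such that $W=\bigoplus_{i=n_0}^{n_1}W(i)$, $W(n_0)\ne 0$ and $W(n_1)\neq 0$. For these, $$\mathcal{F}^\delta_nW=\bigoplus_{i=n_0}^{n_0+n}W(i),\qquad \mathcal{F}^\mu_nW=\bigoplus_{i=n_1-n}^{n_1}W(i)\qquad\text{for all } n\ge 0.$$ Moreover, $W(n_0)$ and $W(n_1)$ are irreducible left Yetter-Drinfeld modules over $R(0)\#H$, where the action and coaction arise from the action and coaction of $R\#H$ on $W$ by restriction and projection, respectively. -/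

import Mathlib

open scoped TensorProduct

namespace BosonizationYD

noncomputable section

/-- The structure maps of a (braided or ordinary) Hopf algebra on a `k`-vector space `A`.
The laws are imposed where they are needed. -/
structure HopfMaps (k A : Type*) [Field k] [AddCommGroup A] [Module k A] where
  mul : A ⊗[k] A →ₗ[k] A
  one : A
  comul : A →ₗ[k] A ⊗[k] A
  counit : A →ₗ[k] k
  antipode : A →ₗ[k] A

/-- An action `A ⊗ V → V` and a coaction `V → A ⊗ V`, not yet subject to any law. -/
structure ActCoact (k A V : Type*) [Field k] [AddCommGroup A] [Module k A]
    [AddCommGroup V] [Module k V] where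
  act : A ⊗[k] V →ₗ[k] V
  coact : V →ₗ[k] A ⊗[k] V

/-- For subspaces `p ⊆ V`, `q ⊆ U`, the subspace `p ⊗ q` of `V ⊗ U`. -/
def tens {k V U : Type*} [Field k] [AddCommGroup V] [Module k V] [AddCommGroup U] [Module k U]
    (p : Submodule k V) (q : Submodule k U) : Submodule k (V ⊗[k] U) :=
  LinearMap.range (TensorProduct.mapIncl p q)

/-- `(a ⊗ b) ⊗ (a' ⊗ b') ↦ (a ⊗ x) ⊗ (y ⊗ b')`, where `t (b ⊗ a') = x ⊗ y` (a sum of such). -/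
def interchange {k A B A' B' X Y : Type*} [Field k] [AddCommGroup A] [Module k A]
    [AddCommGroup B] [Module k B] [AddCommGroup A'] [Module k A'] [AddCommGroup B'] [Module k B']
    [AddCommGroup X] [Module k X] [AddCommGroup Y] [Module k Y]
    (t : B ⊗[k] A' →ₗ[k] X ⊗[k] Y) :
    (A ⊗[k] B) ⊗[k] (A' ⊗[k] B') →ₗ[k] (A ⊗[k] X) ⊗[k] (Y ⊗[k] B') :=
  (TensorProduct.assoc k A X (Y ⊗[k] B')).symm.toLinearMap ∘ₗ
    LinearMap.lTensor A ((TensorProduct.assoc k X Y B').toLinearMap ∘ₗ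
      LinearMap.rTensor B' t ∘ₗ (TensorProduct.assoc k B A' B').symm.toLinearMap) ∘ₗ
    (TensorProduct.assoc k A B (A' ⊗[k] B')).toLinearMap

section YetterDrinfeld

variable {k A V U : Type*} [Field k] [AddCommGroup A] [Module k A]
  [AddCommGroup V] [Module k V] [AddCommGroup U] [Module k U]

/-- The map `(a₁ ⊗ (a₂ ⊗ a₃)) ⊗ (c ⊗ v) ↦ a₁ c S(a₃) ⊗ a₂ v`. -/
def ydTwist (𝓐 : HopfMaps k A) (M : ActCoact k A V) :
    (A ⊗[k] (A ⊗[k] A)) ⊗[k] (A ⊗[k] V) →ₗ[k] A ⊗[k] V :=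
  TensorProduct.map
      (𝓐.mul ∘ₗ TensorProduct.map 𝓐.mul 𝓐.antipode ∘ₗ
        (TensorProduct.rightComm k A A A).toLinearMap) M.act ∘ₗ
    (TensorProduct.tensorTensorTensorComm k (A ⊗[k] A) A A V).toLinearMap ∘ₗ
    LinearMap.rTensor (A ⊗[k] V)
      ((TensorProduct.assoc k A A A).symm.toLinearMap ∘ₗ
        LinearMap.lTensor A (TensorProduct.comm k A A).toLinearMap)

theorem ydTwist_tmul (𝓐 : HopfMaps k A) (M : ActCoact k A V) (a₁ a₂ a₃ c : A) (v : V) :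
    ydTwist 𝓐 M ((a₁ ⊗ₜ (a₂ ⊗ₜ a₃)) ⊗ₜ (c ⊗ₜ v)) =
      𝓐.mul (𝓐.mul (a₁ ⊗ₜ c) ⊗ₜ 𝓐.antipode a₃) ⊗ₜ M.act (a₂ ⊗ₜ v) := rfl

/-- `V` is a left Yetter-Drinfeld module over `A`: a left module and a left comodule with
`δ(a v) = a₁ v₍₋₁₎ S(a₃) ⊗ a₂ v₍₀₎`. -/
structure IsYD (𝓐 : HopfMaps k A) (M : ActCoact k A V) : Prop where
  one_act : ∀ v : V, M.act (𝓐.one ⊗ₜ v) = v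
  mul_act : ∀ (a b : A) (v : V), M.act (𝓐.mul (a ⊗ₜ b) ⊗ₜ v) = M.act (a ⊗ₜ M.act (b ⊗ₜ v))
  counit_coact : ∀ v : V, TensorProduct.lid k V (𝓐.counit.rTensor V (M.coact v)) = v
  coassoc : ∀ v : V, TensorProduct.assoc k A A V (𝓐.comul.rTensor V (M.coact v)) =
    M.coact.lTensor A (M.coact v)
  coact_act : ∀ (a : A) (v : V), M.coact (M.act (a ⊗ₜ v)) =
    ydTwist 𝓐 M (𝓐.comul.lTensor A (𝓐.comul a) ⊗ₜ M.coact v)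

/-- The subspace `N` is a Yetter-Drinfeld submodule: a submodule and a subcomodule. -/
structure IsYDSub (M : ActCoact k A V) (N : Submodule k V) : Prop where
  act_mem : ∀ (a : A), ∀ v ∈ N, M.act (a ⊗ₜ v) ∈ N
  coact_mem : ∀ v ∈ N, M.coact v ∈ tens (⊤ : Submodule k A) N

/-- `V` is an irreducible Yetter-Drinfeld module over `A`. -/
structure IsIrreducibleYD (𝓐 : HopfMaps k A) (M : ActCoact k A V) : Prop where
  isYD : IsYD 𝓐 M
  nontrivial : Nontrivial V
  eq_bot_or_top : ∀ N : Submodule k V, IsYDSub M N → N = ⊥ ∨ N = ⊤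

/-- Morphisms of Yetter-Drinfeld modules: linear and colinear maps. -/
structure IsYDHom (M : ActCoact k A V) (N : ActCoact k A U) (f : V →ₗ[k] U) : Prop where
  map_act : ∀ (a : A) (v : V), f (M.act (a ⊗ₜ v)) = N.act (a ⊗ₜ f v)
  map_coact : ∀ v : V, N.coact (f v) = f.lTensor A (M.coact v)

/-- The unit object: `a • c = ε(a) c`, `δ(c) = 1 ⊗ c` on the ground field. -/
def ActCoact.unitObject (𝓐 : HopfMaps k A) : ActCoact k A k where
  act := (TensorProduct.lid k k).toLinearMap ∘ₗ 𝓐.counit.rTensor k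
  coact := TensorProduct.mk k A k 𝓐.one

/-- The tensor product with diagonal action `a (v ⊗ u) = a₁ v ⊗ a₂ u` and diagonal coaction
`δ(v ⊗ u) = v₍₋₁₎ u₍₋₁₎ ⊗ (v₍₀₎ ⊗ u₍₀₎)`. -/
def ActCoact.tensor (𝓐 : HopfMaps k A) (M : ActCoact k A V) (N : ActCoact k A U) :
    ActCoact k A (V ⊗[k] U) where
  act := TensorProduct.map M.act N.act ∘ₗ
    (TensorProduct.tensorTensorTensorComm k A A V U).toLinearMap ∘ₗ
    𝓐.comul.rTensor (V ⊗[k] U)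
  coact := 𝓐.mul.rTensor (V ⊗[k] U) ∘ₗ
    (TensorProduct.tensorTensorTensorComm k A V A U).toLinearMap ∘ₗ
    TensorProduct.map M.coact N.coact

/-- The braiding `v ⊗ u ↦ v₍₋₁₎ u ⊗ v₍₀₎`. -/
def braiding (M : ActCoact k A V) (N : ActCoact k A U) : V ⊗[k] U →ₗ[k] U ⊗[k] V :=
  N.act.rTensor V ∘ₗ (TensorProduct.rightComm k A V U).toLinearMap ∘ₗ M.coact.rTensor U

end YetterDrinfeld

/-- The structure maps of an ordinary Hopf algebra. -/
def HopfMaps.ofHopfAlgebra (k H : Type*) [Field k] [Ring H] [HopfAlgebra k H] :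
    HopfMaps k H where
  mul := LinearMap.mul' k H
  one := 1
  comul := Coalgebra.comul
  counit := Coalgebra.counit
  antipode := HopfAlgebra.antipode k

/-- A Hopf algebra `R` in the braided monoidal category of left Yetter-Drinfeld modules over `H`.
The algebra and the coalgebra structure of `R` are given by type classes; this structure adds the
`H`-action, the `H`-coaction and the antipode, and requires all structure maps to be morphisms of
Yetter-Drinfeld modules, `Δ` and `ε` to be algebra maps (for the algebra `R ⊗ R` whose
multiplication uses the braiding), and the antipode to be the convolution inverse of the
identity. -/
structure YDHopfAlgebra (k H R : Type*) [Field k] [Ring H] [HopfAlgebra k H]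
    [Ring R] [Algebra k R] [Coalgebra k R] extends ActCoact k H R where
  antipode : R →ₗ[k] R
  isYD : IsYD (HopfMaps.ofHopfAlgebra k H) toActCoact
  mul_hom : IsYDHom (ActCoact.tensor (HopfMaps.ofHopfAlgebra k H) toActCoact toActCoact)
    toActCoact (LinearMap.mul' k R)
  unit_hom : IsYDHom (ActCoact.unitObject (HopfMaps.ofHopfAlgebra k H)) toActCoact
    (Algebra.linearMap k R)
  comul_hom : IsYDHom toActCoact
    (ActCoact.tensor (HopfMaps.ofHopfAlgebra k H) toActCoact toActCoact) Coalgebra.comul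
  counit_hom : IsYDHom toActCoact (ActCoact.unitObject (HopfMaps.ofHopfAlgebra k H))
    Coalgebra.counit
  antipode_hom : IsYDHom toActCoact toActCoact antipode
  comul_one : Coalgebra.comul (R := k) (1 : R) = 1 ⊗ₜ[k] 1
  comul_mul : ∀ r s : R, Coalgebra.comul (R := k) (r * s) =
    TensorProduct.map (LinearMap.mul' k R) (LinearMap.mul' k R)
      (interchange (braiding toActCoact toActCoact)
        (Coalgebra.comul (R := k) r ⊗ₜ[k] Coalgebra.comul (R := k) s))
  counit_one : Coalgebra.counit (R := k) (1 : R) = 1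
  counit_mul : ∀ r s : R, Coalgebra.counit (R := k) (r * s) =
    Coalgebra.counit (R := k) r * Coalgebra.counit (R := k) s
  antipode_mul_id : ∀ r : R, LinearMap.mul' k R (antipode.rTensor R (Coalgebra.comul r)) =
    algebraMap k R (Coalgebra.counit r)
  id_mul_antipode : ∀ r : R, LinearMap.mul' k R (antipode.lTensor R (Coalgebra.comul r)) =
    algebraMap k R (Coalgebra.counit r)

/-- The structure maps of the braided Hopf algebra `R`. -/
def YDHopfAlgebra.hopfMaps {k H R : Type*} [Field k] [Ring H] [HopfAlgebra k H]
    [Ring R] [Algebra k R] [Coalgebra k R] (𝓡 : YDHopfAlgebra k H R) : HopfMaps k R where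
  mul := LinearMap.mul' k R
  one := 1
  comul := Coalgebra.comul
  counit := Coalgebra.counit
  antipode := 𝓡.antipode

section Bosonization

variable {k H R : Type*} [Field k] [AddCommGroup H] [Module k H] [AddCommGroup R] [Module k R]

/-- `h ⊗ r ↦ h₁ • r ⊗ h₂`. -/
def smashSwap (𝓗 : HopfMaps k H) (M : ActCoact k H R) : H ⊗[k] R →ₗ[k] R ⊗[k] H :=
  M.act.rTensor H ∘ₗ (TensorProduct.rightComm k H H R).toLinearMap ∘ₗ 𝓗.comul.rTensor R

/-- `r ⊗ h ↦ r₍₋₁₎ h ⊗ r₍₀₎`. -/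
def cosmashSwap (𝓗 : HopfMaps k H) (M : ActCoact k H R) : R ⊗[k] H →ₗ[k] H ⊗[k] R :=
  𝓗.mul.rTensor R ∘ₗ (TensorProduct.rightComm k H R H).toLinearMap ∘ₗ M.coact.rTensor H

/-- The smash product `(r # h)(r' # h') = r (h₁ • r') # h₂ h'`. -/
def smashMul (𝓗 : HopfMaps k H) (𝓡 : HopfMaps k R) (M : ActCoact k H R) :
    (R ⊗[k] H) ⊗[k] (R ⊗[k] H) →ₗ[k] R ⊗[k] H :=
  TensorProduct.map 𝓡.mul 𝓗.mul ∘ₗ interchange (smashSwap 𝓗 M)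

/-- The bosonization `R # H`: the vector space `R ⊗ H` with the smash product, the cosmash
coproduct `Δ(r # h) = (r¹ # (r²)₍₋₁₎ h₁) ⊗ ((r²)₍₀₎ # h₂)`, the counit `ε(r) ε(h)` and the
antipode `S(r # h) = (1 # S(r₍₋₁₎ h)) (S_R(r₍₀₎) # 1)`. -/
def bosonization (𝓗 : HopfMaps k H) (𝓡 : HopfMaps k R) (M : ActCoact k H R) :
    HopfMaps k (R ⊗[k] H) where
  mul := smashMul 𝓗 𝓡 M
  one := 𝓡.one ⊗ₜ 𝓗.one
  comul := interchange (cosmashSwap 𝓗 M) ∘ₗ TensorProduct.map 𝓡.comul 𝓗.comul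
  counit := (TensorProduct.lid k k).toLinearMap ∘ₗ TensorProduct.map 𝓡.counit 𝓗.counit
  antipode := smashMul 𝓗 𝓡 M ∘ₗ
    TensorProduct.map
      (TensorProduct.mk k R H 𝓡.one ∘ₗ 𝓗.antipode)
      ((TensorProduct.mk k R H).flip 𝓗.one ∘ₗ 𝓡.antipode) ∘ₗ
    cosmashSwap 𝓗 M

end Bosonization

/-- The bosonization of a Hopf algebra in the category of Yetter-Drinfeld modules over `H`. -/
def YDHopfAlgebra.bosonization {k H R : Type*} [Field k] [Ring H] [HopfAlgebra k H]
    [Ring R] [Algebra k R] [Coalgebra k R] (𝓡 : YDHopfAlgebra k H R) :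
    HopfMaps k (R ⊗[k] H) :=
  BosonizationYD.bosonization (HopfMaps.ofHopfAlgebra k H) 𝓡.hopfMaps 𝓡.toActCoact

/-- `R = ⨁ R(n)` is an `ℕ`-graded Hopf algebra in the category of Yetter-Drinfeld modules over
`H`: all `R(n)` are Yetter-Drinfeld submodules and the structure maps are graded. -/
structure IsGradedYDHopfAlgebra {k H R : Type*} [Field k] [Ring H] [HopfAlgebra k H]
    [Ring R] [Algebra k R] [Coalgebra k R] (𝓡 : YDHopfAlgebra k H R)
    (ℛ : ℕ → Submodule k R) [DirectSum.Decomposition ℛ] : Prop where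
  isYDSub : ∀ n, IsYDSub 𝓡.toActCoact (ℛ n)
  one_mem : (1 : R) ∈ ℛ 0
  mul_mem : ∀ m n, ∀ r ∈ ℛ m, ∀ s ∈ ℛ n, r * s ∈ ℛ (m + n)
  comul_mem : ∀ n, ∀ r ∈ ℛ n,
    Coalgebra.comul r ∈ ⨆ (i : ℕ) (j : ℕ) (_ : i + j = n), tens (ℛ i) (ℛ j)
  counit_eq_zero : ∀ n, n ≠ 0 → ∀ r ∈ ℛ n, Coalgebra.counit (R := k) r = 0
  antipode_mem : ∀ n, ∀ r ∈ ℛ n, 𝓡.antipode r ∈ ℛ n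

section Graded

variable {k : Type*} [Field k]

/-- The projection of a graded vector space onto its component of degree `i`. -/
def proj {ι V : Type*} [DecidableEq ι] [AddCommGroup V] [Module k V] (𝒱 : ι → Submodule k V)
    [DirectSum.Decomposition 𝒱] (i : ι) : V →ₗ[k] 𝒱 i :=
  DirectSum.component k ι (fun j => 𝒱 j) i ∘ₗ (DirectSum.decomposeLinearEquiv 𝒱).toLinearMap

variable {H R W : Type*} [Ring H] [HopfAlgebra k H] [Ring R] [Algebra k R] [Coalgebra k R]
  [AddCommGroup W] [Module k W]

/-- The structure maps of the degree zero part `R(0)`. They are those of `R`, whose values on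
`R(0)` have degree zero when `R` is graded; the projections are only there to land in `R(0)`. -/
def zeroHopfMaps (𝓡 : YDHopfAlgebra k H R) (ℛ : ℕ → Submodule k R)
    [DirectSum.Decomposition ℛ] : HopfMaps k (ℛ 0) where
  mul := proj ℛ 0 ∘ₗ LinearMap.mul' k R ∘ₗ TensorProduct.map (ℛ 0).subtype (ℛ 0).subtype
  one := proj ℛ 0 1
  comul := TensorProduct.map (proj ℛ 0) (proj ℛ 0) ∘ₗ Coalgebra.comul ∘ₗ (ℛ 0).subtype
  counit := Coalgebra.counit ∘ₗ (ℛ 0).subtype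
  antipode := proj ℛ 0 ∘ₗ 𝓡.antipode ∘ₗ (ℛ 0).subtype

/-- The `H`-action and `H`-coaction of `R(0)`, restricted from `R`. -/
def zeroActCoact (𝓡 : YDHopfAlgebra k H R) (ℛ : ℕ → Submodule k R)
    [DirectSum.Decomposition ℛ] : ActCoact k H (ℛ 0) where
  act := proj ℛ 0 ∘ₗ 𝓡.act ∘ₗ (ℛ 0).subtype.lTensor H
  coact := (proj ℛ 0).lTensor H ∘ₗ 𝓡.coact ∘ₗ (ℛ 0).subtype

/-- The bosonization `R(0) # H`. -/
def zeroBosonization (𝓡 : YDHopfAlgebra k H R) (ℛ : ℕ → Submodule k R)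
    [DirectSum.Decomposition ℛ] : HopfMaps k (ℛ 0 ⊗[k] H) :=
  bosonization (HopfMaps.ofHopfAlgebra k H) (zeroHopfMaps 𝓡 ℛ) (zeroActCoact 𝓡 ℛ)

/-- `W = ⨁ W(m)` (over `m : ℤ`) is a `ℤ`-graded Yetter-Drinfeld module over `R # H`, where
`R(n) # H` has degree `n`. -/
structure IsGradedYD (𝓡 : YDHopfAlgebra k H R) (ℛ : ℕ → Submodule k R)
    (M : ActCoact k (R ⊗[k] H) W) (𝒲 : ℤ → Submodule k W) [DirectSum.Decomposition 𝒲] :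
    Prop where
  isYD : IsYD 𝓡.bosonization M
  act_mem : ∀ (n : ℕ) (m : ℤ), ∀ a ∈ tens (ℛ n) (⊤ : Submodule k H), ∀ w ∈ 𝒲 m,
    M.act (a ⊗ₜ w) ∈ 𝒲 (n + m)
  coact_mem : ∀ m : ℤ, ∀ w ∈ 𝒲 m,
    M.coact w ∈ ⨆ n : ℕ, tens (tens (ℛ n) (⊤ : Submodule k H)) (𝒲 (m - n))

/-- `W` is an irreducible object in the category of `ℤ`-graded Yetter-Drinfeld modules over
`R # H`: it is nonzero and has no graded Yetter-Drinfeld submodules besides `0` and `W`. -/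
structure IsIrreducibleGradedYD (𝓡 : YDHopfAlgebra k H R) (ℛ : ℕ → Submodule k R)
    (M : ActCoact k (R ⊗[k] H) W) (𝒲 : ℤ → Submodule k W) [DirectSum.Decomposition 𝒲] :
    Prop where
  isGradedYD : IsGradedYD 𝓡 ℛ M 𝒲
  nontrivial : Nontrivial W
  eq_bot_or_top : ∀ N : Submodule k W, IsYDSub M N → N = (⨆ m, N ⊓ 𝒲 m) → N = ⊥ ∨ N = ⊤

/-- `W` is locally finite as an `R`-module, where `r` acts as `r # 1`. -/
def IsLocallyFinite (M : ActCoact k (R ⊗[k] H) W) : Prop :=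
  ∀ w : W, ∃ U : Submodule k W, FiniteDimensional k U ∧ w ∈ U ∧
    ∀ (r : R), ∀ u ∈ U, M.act ((r ⊗ₜ 1) ⊗ₜ u) ∈ U

/-- The `R`-coaction `δ^R = (ϑ ⊗ id) δ` of `W`, where `ϑ (r # h) = r ε(h)`. -/
def coactR (M : ActCoact k (R ⊗[k] H) W) : W →ₗ[k] R ⊗[k] W :=
  LinearMap.rTensor W ((TensorProduct.rid k R).toLinearMap ∘ₗ
    LinearMap.lTensor R (Coalgebra.counit : H →ₗ[k] k)) ∘ₗ M.coact

/-- `F^δ_n W = {w | δ^R(w) ∈ (R(0) ⊕ ⋯ ⊕ R(n)) ⊗ W}`. -/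
def Fdelta (ℛ : ℕ → Submodule k R) (M : ActCoact k (R ⊗[k] H) W) (n : ℕ) : Submodule k W :=
  (tens (⨆ i ∈ Set.Iic n, ℛ i) (⊤ : Submodule k W)).comap (coactR M)

/-- `F^μ_n W = {w | R(i) w = 0 for all i > n}`. -/
def Fmu (ℛ : ℕ → Submodule k R) (M : ActCoact k (R ⊗[k] H) W) (n : ℕ) : Submodule k W where
  carrier := {w | ∀ i, n < i → ∀ r ∈ ℛ i, M.act ((r ⊗ₜ 1) ⊗ₜ w) = 0}
  zero_mem' := fun i _ r _ => by rw [TensorProduct.tmul_zero, map_zero]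
  add_mem' := fun ha hb i hi r hr => by
    rw [TensorProduct.tmul_add, map_add, ha i hi r hr, hb i hi r hr, add_zero]
  smul_mem' := fun c w hw i hi r hr => by
    rw [TensorProduct.tmul_smul, map_smul, hw i hi r hr, smul_zero]

/-- `n₀` and `n₁` are the lowest and the highest degree of `W`:
`W = W(n₀) ⊕ ⋯ ⊕ W(n₁)`, `W(n₀) ≠ 0` and `W(n₁) ≠ 0`. -/
structure IsDegreeRange (𝒲 : ℤ → Submodule k W) (n₀ n₁ : ℤ) : Prop where
  le : n₀ ≤ n₁
  eq_bot : ∀ i, i ∉ Set.Icc n₀ n₁ → 𝒲 i = ⊥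
  low_ne_bot : 𝒲 n₀ ≠ ⊥
  high_ne_bot : 𝒲 n₁ ≠ ⊥

/-- The action and coaction of `R(0) # H` on the component `W(m)`, obtained from those of
`R # H` on `W` by restriction and projection. -/
def component (ℛ : ℕ → Submodule k R) [DirectSum.Decomposition ℛ]
    (M : ActCoact k (R ⊗[k] H) W) (𝒲 : ℤ → Submodule k W) [DirectSum.Decomposition 𝒲] (m : ℤ) :
    ActCoact k (ℛ 0 ⊗[k] H) (𝒲 m) where
  act := proj 𝒲 m ∘ₗ M.act ∘ₗ
    TensorProduct.map ((ℛ 0).subtype.rTensor H) (𝒲 m).subtype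
  coact := TensorProduct.map ((proj ℛ 0).rTensor H) (proj 𝒲 m) ∘ₗ M.coact ∘ₗ (𝒲 m).subtype

end Graded

end

end BosonizationYD

/-!
Write `A = R # H`, let `A(n) = R(n) # H`, and let `W` be an irreducible graded Yetter-Drinfeld
module over `A`. The proof rests on two ways of producing Yetter-Drinfeld submodules.

* If `N ⊆ W` is a subcomodule, then `A N` is a Yetter-Drinfeld submodule, because
  `δ(a v) = a₁ v₍₋₁₎ S(a₃) ⊗ a₂ v₍₀₎` (`isYDSub_actSpan`).
* If `N ⊆ W` is a submodule, then the span of the coefficients of `δ(v)`, `v ∈ N`, is a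
  Yetter-Drinfeld submodule, because `v₍₋₁₎ ⊗ a v₍₀₎ = S(a₁) (a₂ v)₍₋₁₎ a₃ ⊗ (a₂ v)₍₀₎`
  (`lTensor_act_coact`, `isYDSub_coactSpan`).

Suppose that `N ≠ 0` consists of elements of degree `m`. In the first case `W = A N` lives in
degrees `≥ m`, since `A` acts with nonnegative degrees, and `W(m) = A(0) N`; in the second case
`W` is spanned by the coefficients of `δ(N)`, hence lives in degrees `≤ m`, and `W(m)` is spanned by the
coefficients of the `A(0)`-component of `δ(N)`. This applies to the following subspaces.

* `lowVec`: the `w ∈ W(m)` with `δ(w) ∈ A(0) ⊗ W`. It is a subcomodule, so it can be nonzero only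
  if `m` is the lowest degree of `W`. By coassociativity, the coefficients of the component of
  highest `A`-degree of any `δ(w)` lie in some `lowVec` (`IsGradedYDFamily.slice_mem_lowVec`).
* `highVec`: the `w ∈ W(m)` killed by `A(j)` for all `j > 0`. It is a submodule, so it can be
  nonzero only if `m` is the highest degree. If `n` is the largest degree for which `A(n) w ≠ 0`,
  then `A(n) w` lies in some `highVec`; local finiteness provides such an `n`.

Thus `W` has a lowest and a highest degree. If `w ∈ W(i)` is nonzero and lies in the `n`-th step of
`F^δ`, then the coefficients of its top component are in `lowVec` of degree at least `i - n`,
whence `i ≤ n₀ + n`; dually, `F^μ` is computed with `highVec`. A nonzero Yetter-Drinfeld submodule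
of `W(n₀)` is a subcomodule of `W`, and one of `W(n₁)` is a submodule of `W`, so the two
constructions show that both components are irreducible.

The filtrations are defined with `R` instead of `A`. For the coaction, `δ` is recovered from `δ^R`
(`assoc_coact`); for the action, `r # h = (1 # h₂) (S⁻¹(h₁) • r # 1)` shows that an element killed
by `R(j)` is killed by `A(j)` (`act_eq_zero_of_left`), which is where the bijectivity of the
antipode of `H` enters. The second construction also needs the algebra and coalgebra axioms and one
antipode axiom for `A`; they are proved in `bosonization_isLeftHopf`.
-/

namespace BosonizationYD

/-! ### Coefficients of tensors -/

section Slices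

variable {k A V U : Type*} [Field k] [AddCommGroup A] [Module k A]
  [AddCommGroup V] [Module k V] [AddCommGroup U] [Module k U]

theorem tens_le {p : Submodule k V} {q : Submodule k U} {Z : Submodule k (V ⊗[k] U)} :
    tens p q ≤ Z ↔ ∀ a ∈ p, ∀ b ∈ q, a ⊗ₜ[k] b ∈ Z := by
  rw [tens, TensorProduct.range_mapIncl, Submodule.map₂_le]
  rfl

theorem tmul_mem_tens {p : Submodule k V} {q : Submodule k U} {a : V} {b : U}
    (ha : a ∈ p) (hb : b ∈ q) : a ⊗ₜ[k] b ∈ tens p q :=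
  tens_le.1 le_rfl a ha b hb

/-- The coefficient `(f ⊗ id) x` of a tensor `x`. -/
noncomputable def slice (f : A →ₗ[k] k) : A ⊗[k] V →ₗ[k] V :=
  (TensorProduct.lid k V).toLinearMap ∘ₗ f.rTensor V

@[simp] theorem slice_tmul (f : A →ₗ[k] k) (a : A) (v : V) :
    slice f (a ⊗ₜ[k] v) = f a • v := by
  simp [slice]

theorem slice_rTensor (f : A →ₗ[k] k) (g : U →ₗ[k] A) (x : U ⊗[k] V) :
    slice f (g.rTensor V x) = slice (f ∘ₗ g) x := by
  induction x <;> simp_all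

theorem slice_lTensor (f : A →ₗ[k] k) (g : V →ₗ[k] U) (x : A ⊗[k] V) :
    slice f (g.lTensor A x) = g (slice f x) := by
  induction x <;> simp_all

/-- The coefficients of a tensor at the coordinate functionals of a basis determine it. -/
theorem exists_slice_repr (x : A ⊗[k] V) :
    ∃ s : Finset (A × (A →ₗ[k] k)), x = ∑ p ∈ s, p.1 ⊗ₜ[k] slice p.2 x := by
  classical
  let B := Module.Basis.ofVectorSpace k A
  obtain ⟨c, rfl⟩ := TensorProduct.eq_repr_basis_left B x
  refine ⟨c.support.image fun i => (B i, B.coord i), ?_⟩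
  rw [Finset.sum_image fun i _ j _ h => B.injective (Prod.ext_iff.1 h).1, Finsupp.sum]
  refine Finset.sum_congr rfl fun i hi => ?_
  rw [map_sum]
  congr 1
  rw [Finset.sum_eq_single i]
  · simp
  · intro j _ hj
    simp [Finsupp.single_eq_of_ne hj.symm]
  · intro h
    exact absurd hi h

theorem mem_tens_top_iff {N : Submodule k V} {x : A ⊗[k] V} :
    x ∈ tens (⊤ : Submodule k A) N ↔ ∀ f : A →ₗ[k] k, slice f x ∈ N := by
  constructor
  · intro hx f
    have : tens (⊤ : Submodule k A) N ≤ N.comap (slice f) :=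
      tens_le.2 fun a _ b hb => by
        simpa using N.smul_mem _ hb
    exact this hx
  · intro h
    obtain ⟨s, hx⟩ := exists_slice_repr x
    rw [hx]
    exact Submodule.sum_mem _ fun a _ => tmul_mem_tens trivial (h _)

theorem eq_zero_of_slice {x : A ⊗[k] V} (h : ∀ f : A →ₗ[k] k, slice f x = 0) : x = 0 := by
  obtain ⟨s, hx⟩ := exists_slice_repr x
  rw [hx]
  exact Finset.sum_eq_zero fun a _ => by rw [h, TensorProduct.tmul_zero]

end Slices

/-! ### Families of homogeneous components -/

section Components

variable {k ι V U : Type*} [Field k] [DecidableEq ι] [AddCommGroup V] [Module k V]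
  [AddCommGroup U] [Module k U]

/-- A grading of `V`, encoded by the endomorphisms `e i` that project onto the homogeneous
components. -/
structure IsComponentFamily (e : ι → V →ₗ[k] V) : Prop where
  orth : ∀ i j v, e i (e j v) = if i = j then e j v else 0
  complete : ∀ v, ∃ s : Finset ι, ∑ i ∈ s, e i v = v

namespace IsComponentFamily

variable {e : ι → V →ₗ[k] V} (he : IsComponentFamily e)
include he

theorem idem (i : ι) (v : V) : e i (e i v) = e i v := by simp [he.orth]

theorem eq_zero_of_notMem {s : Finset ι} {v : V} (hs : ∑ i ∈ s, e i v = v) {i : ι}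
    (hi : i ∉ s) : e i v = 0 := by
  rw [← hs, map_sum]
  refine Finset.sum_eq_zero fun j hj => ?_
  rw [he.orth, if_neg]
  rintro rfl
  exact hi hj

theorem eq_zero {v : V} (h : ∀ i, e i v = 0) : v = 0 := by
  obtain ⟨s, hs⟩ := he.complete v
  rw [← hs]
  exact Finset.sum_eq_zero fun i _ => h i

theorem mem {N : Submodule k V} {v : V} (h : ∀ i, e i v ∈ N) : v ∈ N := by
  obtain ⟨s, hs⟩ := he.complete v
  rw [← hs]
  exact Submodule.sum_mem _ fun i _ => h i

theorem ext_components {f g : V →ₗ[k] U} (h : ∀ i v, f (e i v) = g (e i v)) : f = g := by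
  ext v
  obtain ⟨s, hs⟩ := he.complete v
  rw [← hs, map_sum, map_sum]
  exact Finset.sum_congr rfl fun i _ => h i v

theorem rTensor : IsComponentFamily fun i => (e i).rTensor U where
  orth i j x := by
    rw [← LinearMap.rTensor_comp_apply]
    split_ifs with h
    · subst h
      congr 2
      ext v
      exact he.idem i v
    · have : e i ∘ₗ e j = 0 := by
        ext v
        simp [he.orth, h]
      simp [this]
  complete x := by
    classical
    induction x with
    | zero => exact ⟨∅, by simp⟩
    | tmul v u =>
      obtain ⟨s, hs⟩ := he.complete v
      exact ⟨s, by simp only [LinearMap.rTensor_tmul, ← TensorProduct.sum_tmul, hs]⟩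
    | add x y hx hy =>
      -- enlarging the index set beyond the support does not change the sum
      have key : ∀ (z : V ⊗[k] U) (s t : Finset ι), s ⊆ t → (∑ i ∈ s, (e i).rTensor U z) = z →
          (∑ i ∈ t, (e i).rTensor U z) = z := by
        intro z s t hst hs
        rw [← Finset.sum_subset hst, hs]
        intro i _ hi
        rw [← hs, map_sum]
        refine Finset.sum_eq_zero fun j hj => ?_
        have : e i ∘ₗ e j = 0 := by
          ext v
          rw [LinearMap.comp_apply, he.orth, if_neg]
          · rfl
          · rintro rfl
            exact hi hj
        rw [← LinearMap.rTensor_comp_apply, this]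
        simp
      obtain ⟨s, hs⟩ := hx
      obtain ⟨t, ht⟩ := hy
      refine ⟨s ∪ t, ?_⟩
      simp only [map_add, Finset.sum_add_distrib]
      rw [key x s _ Finset.subset_union_left hs, key y t _ Finset.subset_union_right ht]

end IsComponentFamily

/-- The projection onto the component of degree `i`, as an endomorphism. -/
noncomputable def comp (𝒱 : ι → Submodule k V) [DirectSum.Decomposition 𝒱] (i : ι) : V →ₗ[k] V :=
  (𝒱 i).subtype ∘ₗ proj 𝒱 i

section

variable (𝒱 : ι → Submodule k V) [DirectSum.Decomposition 𝒱]

theorem coe_proj (i : ι) (v : V) : (proj 𝒱 i v : V) = comp 𝒱 i v := rfl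

theorem comp_mem (i : ι) (v : V) : comp 𝒱 i v ∈ 𝒱 i := (proj 𝒱 i v).2

variable {𝒱}

theorem comp_of_mem {i : ι} {v : V} (hv : v ∈ 𝒱 i) : comp 𝒱 i v = v :=
  DirectSum.decompose_of_mem_same 𝒱 hv

theorem comp_of_mem_ne {i j : ι} (h : j ≠ i) {v : V} (hv : v ∈ 𝒱 i) : comp 𝒱 j v = 0 :=
  DirectSum.decompose_of_mem_ne 𝒱 hv h.symm

theorem comp_eq_self_iff {i : ι} {v : V} : comp 𝒱 i v = v ↔ v ∈ 𝒱 i :=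
  ⟨fun h => h ▸ comp_mem 𝒱 i v, comp_of_mem⟩

theorem proj_of_mem {i : ι} {v : V} (hv : v ∈ 𝒱 i) : proj 𝒱 i v = ⟨v, hv⟩ :=
  Subtype.ext (comp_of_mem hv)

@[simp] theorem proj_coe {i : ι} (v : 𝒱 i) : proj 𝒱 i v = v := proj_of_mem v.2

variable (𝒱)

theorem isComponentFamily_comp : IsComponentFamily (comp 𝒱) where
  orth i j v := by
    split_ifs with h
    · subst h
      exact comp_of_mem (comp_mem 𝒱 i v)
    · exact comp_of_mem_ne h (comp_mem 𝒱 j v)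
  complete v := by
    classical
    exact ⟨_, DirectSum.sum_support_decompose 𝒱 v⟩

end

/-- A linear identity holds on `V` as soon as it holds on homogeneous elements. -/
theorem ext_homogeneous (𝒱 : ι → Submodule k V) [DirectSum.Decomposition 𝒱] {f g : V →ₗ[k] U}
    (h : ∀ i, ∀ v ∈ 𝒱 i, f v = g v) : f = g :=
  (isComponentFamily_comp 𝒱).ext_components fun i v => h i _ (comp_mem 𝒱 i v)

theorem eq_iSup_inf_of_comp_mem (𝒱 : ι → Submodule k V) [DirectSum.Decomposition 𝒱]
    {N : Submodule k V} (h : ∀ i, ∀ v ∈ N, comp 𝒱 i v ∈ N) : N = ⨆ i, N ⊓ 𝒱 i := by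
  refine le_antisymm (fun v hv => (isComponentFamily_comp 𝒱).mem fun i => ?_)
    (iSup_le fun i => inf_le_left)
  exact Submodule.mem_iSup_of_mem i ⟨h i v hv, comp_mem 𝒱 i v⟩

theorem mem_biSup_iff (𝒱 : ι → Submodule k V) [DirectSum.Decomposition 𝒱] (S : Set ι) {v : V} :
    v ∈ (⨆ i ∈ S, 𝒱 i) ↔ ∀ j ∉ S, comp 𝒱 j v = 0 := by
  constructor
  · intro hv j hj
    have : (⨆ i ∈ S, 𝒱 i) ≤ LinearMap.ker (comp 𝒱 j) :=
      iSup₂_le fun i hi u hu => comp_of_mem_ne (by rintro rfl; exact hj hi) hu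
    exact this hv
  · intro h
    refine (isComponentFamily_comp 𝒱).mem fun i => ?_
    by_cases hi : i ∈ S
    · exact Submodule.mem_iSup_of_mem i (Submodule.mem_iSup_of_mem hi (comp_mem 𝒱 i v))
    · rw [h i hi]
      exact Submodule.zero_mem _

theorem mem_tens_biSup_iff (𝒱 : ι → Submodule k V) [DirectSum.Decomposition 𝒱] (S : Set ι)
    {x : V ⊗[k] U} :
    x ∈ tens (⨆ i ∈ S, 𝒱 i) (⊤ : Submodule k U) ↔ ∀ j ∉ S, (comp 𝒱 j).rTensor U x = 0 := by
  constructor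
  · intro hx j hj
    have : tens (⨆ i ∈ S, 𝒱 i) (⊤ : Submodule k U) ≤ LinearMap.ker ((comp 𝒱 j).rTensor U) :=
      tens_le.2 fun a ha b _ => by
        rw [LinearMap.mem_ker, LinearMap.rTensor_tmul, (mem_biSup_iff 𝒱 S).1 ha j hj,
          TensorProduct.zero_tmul]
    exact this hx
  · intro h
    refine (isComponentFamily_comp 𝒱).rTensor.mem fun i => ?_
    by_cases hi : i ∈ S
    · clear h
      induction x with
      | zero => simp
      | tmul v u =>
        exact tmul_mem_tens
          (Submodule.mem_iSup_of_mem i (Submodule.mem_iSup_of_mem hi (comp_mem 𝒱 i v))) trivial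
      | add x y hx hy => exact (map_add ((comp 𝒱 i).rTensor U) x y) ▸ Submodule.add_mem _ hx hy
    · rw [h i hi]
      exact Submodule.zero_mem _

end Components

/-! ### Yetter-Drinfeld submodules generated and cogenerated by a subspace -/

section Generation

variable {k A W : Type*} [Field k] [AddCommGroup A] [Module k A] [AddCommGroup W] [Module k W]

/-- The part of the Hopf algebra axioms which is used below: no compatibility between
multiplication and comultiplication, and only one of the antipode axioms. -/
structure HopfMaps.IsLeftHopf (𝓐 : HopfMaps k A) : Prop where
  one_mul : ∀ a, 𝓐.mul (𝓐.one ⊗ₜ a) = a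
  mul_one : ∀ a, 𝓐.mul (a ⊗ₜ 𝓐.one) = a
  mul_assoc : ∀ a b c, 𝓐.mul (𝓐.mul (a ⊗ₜ b) ⊗ₜ c) = 𝓐.mul (a ⊗ₜ 𝓐.mul (b ⊗ₜ c))
  counit_comul : ∀ a, TensorProduct.lid k A (𝓐.counit.rTensor A (𝓐.comul a)) = a
  comul_counit : ∀ a, TensorProduct.rid k A (𝓐.counit.lTensor A (𝓐.comul a)) = a
  coassoc : ∀ a, TensorProduct.assoc k A A A (𝓐.comul.rTensor A (𝓐.comul a)) =
    𝓐.comul.lTensor A (𝓐.comul a)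
  antipode_mul : ∀ a, 𝓐.mul (𝓐.antipode.rTensor A (𝓐.comul a)) = 𝓐.counit a • 𝓐.one

variable (𝓐 : HopfMaps k A) (M : ActCoact k A W)

/-- The subspace `A · N`. -/
noncomputable def actSpan (N : Submodule k W) : Submodule k W :=
  (tens (⊤ : Submodule k A) N).map M.act

/-- The span of all coefficients of `δ(v)`, `v ∈ N`. -/
def coactSpan (N : Submodule k W) : Submodule k W :=
  Submodule.span k {u | ∃ (f : A →ₗ[k] k), ∃ v ∈ N, slice f (M.coact v) = u}

variable {𝓐 M}

theorem actSpan_le {N Z : Submodule k W} :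
    actSpan M N ≤ Z ↔ ∀ (a : A), ∀ v ∈ N, M.act (a ⊗ₜ v) ∈ Z := by
  rw [actSpan, Submodule.map_le_iff_le_comap, tens_le]
  exact ⟨fun h a v hv => h a trivial v hv, fun h a _ v hv => h a v hv⟩

theorem act_mem_actSpan {N : Submodule k W} (a : A) {v : W} (hv : v ∈ N) :
    M.act (a ⊗ₜ v) ∈ actSpan M N :=
  actSpan_le.1 le_rfl a v hv

theorem le_actSpan (h : IsYD 𝓐 M) (N : Submodule k W) : N ≤ actSpan M N := fun v hv => by
  simpa [h.one_act] using act_mem_actSpan (M := M) 𝓐.one hv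

theorem slice_mem_coactSpan {N : Submodule k W} (f : A →ₗ[k] k) {v : W} (hv : v ∈ N) :
    slice f (M.coact v) ∈ coactSpan M N :=
  Submodule.subset_span ⟨f, v, hv, rfl⟩

theorem coactSpan_le {N Z : Submodule k W} :
    coactSpan M N ≤ Z ↔ ∀ f : A →ₗ[k] k, ∀ v ∈ N, slice f (M.coact v) ∈ Z := by
  rw [coactSpan, Submodule.span_le]
  constructor
  · intro h f v hv
    exact h ⟨f, v, hv, rfl⟩
  · rintro h _ ⟨f, v, hv, rfl⟩
    exact h f v hv

theorem le_coactSpan (h : IsYD 𝓐 M) (N : Submodule k W) : N ≤ coactSpan M N := fun v hv => by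
  have := slice_mem_coactSpan (M := M) 𝓐.counit hv
  rwa [slice, LinearMap.comp_apply, LinearEquiv.coe_coe, h.counit_coact] at this

/-- A submodule generated by a subcomodule is a Yetter-Drinfeld submodule, since
`δ(a v) = a₁ v₍₋₁₎ S(a₃) ⊗ a₂ v₍₀₎`. -/
theorem isYDSub_actSpan (h : IsYD 𝓐 M) {N : Submodule k W}
    (hN : ∀ v ∈ N, M.coact v ∈ tens (⊤ : Submodule k A) N) : IsYDSub M (actSpan M N) where
  act_mem a w hw := by
    have : actSpan M N ≤ (actSpan M N).comap (M.act ∘ₗ TensorProduct.mk k A W a) :=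
      actSpan_le.2 fun b v hv => by
        simpa [← h.mul_act] using act_mem_actSpan (M := M) (𝓐.mul (a ⊗ₜ b)) hv
    exact this hw
  coact_mem w hw := by
    have : actSpan M N ≤ (tens (⊤ : Submodule k A) (actSpan M N)).comap M.coact :=
      actSpan_le.2 fun a v hv => by
        rw [Submodule.mem_comap, h.coact_act]
        generalize 𝓐.comul.lTensor A (𝓐.comul a) = t
        have hle : tens (⊤ : Submodule k A) N ≤
            (tens (⊤ : Submodule k A) (actSpan M N)).comap
              (ydTwist 𝓐 M ∘ₗ TensorProduct.mk k _ _ t) :=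
          tens_le.2 fun c _ v' hv' => by
            rw [Submodule.mem_comap, LinearMap.comp_apply, TensorProduct.mk_apply]
            induction t with
            | zero => simp
            | tmul a₁ s =>
              induction s with
              | zero => simp
              | tmul a₂ a₃ =>
                rw [ydTwist_tmul]
                exact tmul_mem_tens trivial (act_mem_actSpan _ hv')
              | add x y hx hy =>
                rw [TensorProduct.tmul_add, TensorProduct.add_tmul, map_add]
                exact Submodule.add_mem _ hx hy
            | add x y hx hy =>
              rw [TensorProduct.add_tmul, map_add]
              exact Submodule.add_mem _ hx hy
        exact hle (hN v hv)
    exact this hw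

/-- The map `(a ⊗ b) ⊗ w ↦ (a w)₍₋₁₎ b ⊗ (a w)₍₀₎`. -/
noncomputable def coactMul (𝓐 : HopfMaps k A) (M : ActCoact k A W) :
    (A ⊗[k] A) ⊗[k] W →ₗ[k] A ⊗[k] W :=
  𝓐.mul.rTensor W ∘ₗ (TensorProduct.rightComm k A W A).toLinearMap ∘ₗ
    (M.coact ∘ₗ M.act).rTensor A ∘ₗ (TensorProduct.rightComm k A A W).toLinearMap

theorem coactMul_tmul (a b : A) (w : W) : coactMul 𝓐 M ((a ⊗ₜ b) ⊗ₜ w) =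
    (𝓐.mul ∘ₗ (TensorProduct.mk k A A).flip b).rTensor W (M.coact (M.act (a ⊗ₜ w))) := by
  simp only [coactMul, LinearMap.comp_apply, LinearEquiv.coe_coe, TensorProduct.rightComm_tmul,
    LinearMap.rTensor_tmul]
  generalize M.coact (M.act (a ⊗ₜ w)) = x
  induction x with
  | zero => simp
  | tmul c v => simp
  | add x y hx hy => simp only [TensorProduct.add_tmul, map_add, hx, hy]

/-- The map `(a ⊗ b) ⊗ (c ⊗ w) ↦ a c ⊗ b w`. -/
noncomputable def diagAct (𝓐 : HopfMaps k A) (M : ActCoact k A W) :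
    (A ⊗[k] A) ⊗[k] (A ⊗[k] W) →ₗ[k] A ⊗[k] W :=
  TensorProduct.map 𝓐.mul M.act ∘ₗ (TensorProduct.tensorTensorTensorComm k A A A W).toLinearMap

theorem diagAct_tmul (a b c : A) (w : W) : diagAct 𝓐 M ((a ⊗ₜ b) ⊗ₜ (c ⊗ₜ w)) =
    𝓐.mul (a ⊗ₜ c) ⊗ₜ M.act (b ⊗ₜ w) := rfl

/-- The Yetter-Drinfeld condition without antipode:
`(a₁ w)₍₋₁₎ a₂ ⊗ (a₁ w)₍₀₎ = a₁ w₍₋₁₎ ⊗ a₂ w₍₀₎`. -/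
theorem coactMul_comul (hA : 𝓐.IsLeftHopf) (h : IsYD 𝓐 M) (a : A) (w : W) :
    coactMul 𝓐 M (𝓐.comul a ⊗ₜ w) = diagAct 𝓐 M (𝓐.comul a ⊗ₜ M.coact w) := by
  -- `G ((a₁ ⊗ (a₂ ⊗ a₃)) ⊗ b) = a₁ w₍₋₁₎ S(a₃) b ⊗ a₂ w₍₀₎`
  let G : (A ⊗[k] (A ⊗[k] A)) ⊗[k] A →ₗ[k] A ⊗[k] W :=
    𝓐.mul.rTensor W ∘ₗ (TensorProduct.rightComm k A W A).toLinearMap ∘ₗ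
      (ydTwist 𝓐 M ∘ₗ (TensorProduct.mk k _ _).flip (M.coact w)).rTensor A
  have h1 : ∀ t : A ⊗[k] A, coactMul 𝓐 M (t ⊗ₜ w) =
      G ((𝓐.comul.lTensor A ∘ₗ 𝓐.comul).rTensor A t) := by
    intro t
    induction t with
    | zero => simp
    | tmul b c =>
      simp only [coactMul, G, LinearMap.comp_apply, LinearEquiv.coe_coe,
        TensorProduct.rightComm_tmul, LinearMap.rTensor_tmul, h.coact_act]
      rfl
    | add x y hx hy => simp only [TensorProduct.add_tmul, map_add, hx, hy]
  have h2 : ∀ t : A ⊗[k] (A ⊗[k] A),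
      G ((TensorProduct.assoc k A (A ⊗[k] A) A).symm
        (((TensorProduct.assoc k A A A).symm.toLinearMap ∘ₗ 𝓐.comul.lTensor A).lTensor A t)) =
      diagAct 𝓐 M
        (((TensorProduct.rid k A).toLinearMap ∘ₗ 𝓐.counit.lTensor A).lTensor A t ⊗ₜ
          M.coact w) := by
    intro t
    induction t with
    | zero => simp
    | tmul b s =>
      induction s with
      | zero => simp
      | tmul c d =>
        simp only [LinearMap.lTensor_tmul, LinearMap.comp_apply, LinearEquiv.coe_coe, G,
          TensorProduct.rid_tmul]
        have key : ∀ (p : A ⊗[k] A) (x : A ⊗[k] W),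
            𝓐.mul.rTensor W (TensorProduct.rightComm k A W A
              ((ydTwist 𝓐 M ∘ₗ (TensorProduct.mk k _ _).flip x).rTensor A
                ((TensorProduct.assoc k A (A ⊗[k] A) A).symm
                  (b ⊗ₜ (TensorProduct.assoc k A A A).symm (c ⊗ₜ p))))) =
            (𝓐.mul ∘ₗ (TensorProduct.mk k A A).flip (𝓐.mul (𝓐.antipode.rTensor A p))).rTensor W
              (diagAct 𝓐 M ((b ⊗ₜ c) ⊗ₜ x)) := by
          intro p x
          induction p with
          | zero => simp
          | tmul p₁ p₂ =>
            induction x with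
            | zero => simp
            | tmul y v =>
              simp [ydTwist_tmul, diagAct_tmul, hA.mul_assoc]
            | add x y hx hy =>
              simp only [TensorProduct.tmul_add, map_add, LinearMap.comp_add,
                LinearMap.rTensor_add, LinearMap.add_apply] at hx hy ⊢
              rw [hx, hy]
          | add x y hx hy =>
            simp only [TensorProduct.tmul_add, map_add, LinearMap.comp_add,
                LinearMap.rTensor_add, LinearMap.add_apply] at hx hy ⊢
            rw [hx, hy]
        rw [key, hA.antipode_mul]
        generalize M.coact w = x
        induction x with
        | zero => simp
        | tmul y v =>
          simp only [LinearMap.rTensor_tmul, LinearMap.comp_apply, diagAct_tmul,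
            LinearMap.smul_apply, LinearMap.flip_apply, TensorProduct.mk_apply,
            TensorProduct.tmul_smul, map_smul, hA.mul_one, ← TensorProduct.smul_tmul']
        | add x y hx hy => simp only [TensorProduct.tmul_add, map_add, hx, hy]
      | add x y hx hy => simp only [TensorProduct.tmul_add, TensorProduct.add_tmul, map_add, hx, hy]
    | add x y hx hy => simp only [TensorProduct.add_tmul, map_add, hx, hy]
  have h3 : (𝓐.comul.lTensor A ∘ₗ 𝓐.comul).rTensor A (𝓐.comul a) =
      (TensorProduct.assoc k A (A ⊗[k] A) A).symm
        (((TensorProduct.assoc k A A A).symm.toLinearMap ∘ₗ 𝓐.comul.lTensor A).lTensor A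
          (𝓐.comul.lTensor A (𝓐.comul a))) := by
    have e1 : ∀ t : A ⊗[k] A, (𝓐.comul.lTensor A ∘ₗ 𝓐.comul).rTensor A t =
        (𝓐.comul.lTensor A).rTensor A (𝓐.comul.rTensor A t) := fun t => by
      rw [← LinearMap.rTensor_comp_apply]
    have e2 : ∀ t : (A ⊗[k] A) ⊗[k] A, TensorProduct.assoc k A (A ⊗[k] A) A
          ((𝓐.comul.lTensor A).rTensor A t) =
        (𝓐.comul.rTensor A).lTensor A (TensorProduct.assoc k A A A t) := by
      intro t
      induction t with
      | zero => simp
      | tmul x b =>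
        induction x with
        | zero => simp
        | tmul x y => simp
        | add x y hx hy => simp only [TensorProduct.add_tmul, map_add, hx, hy]
      | add x y hx hy => simp only [map_add, hx, hy]
    rw [LinearEquiv.eq_symm_apply, e1, e2, hA.coassoc, ← LinearMap.lTensor_comp_apply,
      ← LinearMap.lTensor_comp_apply]
    congr 2
    ext b
    simp only [LinearMap.comp_apply, LinearEquiv.coe_coe, ← hA.coassoc,
      LinearEquiv.symm_apply_apply]
  rw [h1, h3, h2, ← LinearMap.lTensor_comp_apply]
  congr 2
  have : (TensorProduct.rid k A).toLinearMap ∘ₗ 𝓐.counit.lTensor A ∘ₗ 𝓐.comul = LinearMap.id := by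
    ext b
    exact hA.comul_counit b
  rw [LinearMap.comp_assoc, this, LinearMap.lTensor_id, LinearMap.id_apply]

/-- `w₍₋₁₎ ⊗ a w₍₀₎ = S(a₁) (a₂ w)₍₋₁₎ a₃ ⊗ (a₂ w)₍₀₎`. -/
theorem lTensor_act_coact (hA : 𝓐.IsLeftHopf) (h : IsYD 𝓐 M) (a : A) (w : W) :
    (M.act ∘ₗ TensorProduct.mk k A W a).lTensor A (M.coact w) =
      𝓐.mul.rTensor W ((TensorProduct.assoc k A A W).symm
        (TensorProduct.map 𝓐.antipode (coactMul 𝓐 M ∘ₗ (TensorProduct.mk k _ _).flip w)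
          (𝓐.comul.lTensor A (𝓐.comul a)))) := by
  have h1 : ∀ t : A ⊗[k] A,
      TensorProduct.map 𝓐.antipode (coactMul 𝓐 M ∘ₗ (TensorProduct.mk k _ _).flip w)
          (𝓐.comul.lTensor A t) =
      TensorProduct.map 𝓐.antipode (diagAct 𝓐 M ∘ₗ (TensorProduct.mk k _ _).flip (M.coact w))
          (𝓐.comul.lTensor A t) := by
    intro t
    induction t with
    | zero => simp
    | tmul b c => simp [coactMul_comul hA h]
    | add x y hx hy => simp only [map_add, hx, hy]
  rw [h1, ← hA.coassoc]
  generalize M.coact w = x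
  have h2 : ∀ t : A ⊗[k] A,
      (M.act ∘ₗ TensorProduct.mk k A W
        (TensorProduct.lid k A (𝓐.counit.rTensor A t))).lTensor A x =
      𝓐.mul.rTensor W ((TensorProduct.assoc k A A W).symm
        (TensorProduct.map 𝓐.antipode (diagAct 𝓐 M ∘ₗ (TensorProduct.mk k _ _).flip x)
          (TensorProduct.assoc k A A A (𝓐.comul.rTensor A t)))) := by
    intro t
    induction t with
    | zero => simp
    | tmul b c =>
      have key : ∀ (x : A ⊗[k] W) (p : A ⊗[k] A),
          𝓐.mul.rTensor W ((TensorProduct.assoc k A A W).symm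
            (TensorProduct.map 𝓐.antipode (diagAct 𝓐 M ∘ₗ (TensorProduct.mk k _ _).flip x)
            (TensorProduct.assoc k A A A (p ⊗ₜ c)))) =
          diagAct 𝓐 M ((𝓐.mul (𝓐.antipode.rTensor A p) ⊗ₜ c) ⊗ₜ x) := by
        intro x p
        induction p with
        | zero => simp
        | tmul p₁ p₂ =>
          induction x with
          | zero => simp
          | tmul y v => simp [diagAct_tmul, hA.mul_assoc]
          | add x y hx hy =>
            simp only [TensorProduct.tmul_add, map_add, LinearMap.comp_add,
              TensorProduct.map_add_right, LinearMap.add_apply] at hx hy ⊢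
            rw [hx, hy]
        | add x y hx hy =>
          simp only [TensorProduct.add_tmul, map_add] at hx hy ⊢
          rw [hx, hy]
      rw [LinearMap.rTensor_tmul, LinearMap.rTensor_tmul, key, hA.antipode_mul]
      clear h1
      induction x with
      | zero => simp
      | tmul y v =>
        simp only [LinearMap.lTensor_tmul, LinearMap.comp_apply, TensorProduct.lid_tmul,
          LinearMap.smul_apply, TensorProduct.mk_apply, diagAct_tmul,
          ← TensorProduct.smul_tmul', map_smul, hA.one_mul, TensorProduct.tmul_smul]
      | add x y hx hy => simp only [TensorProduct.tmul_add, map_add, hx, hy]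
    | add y z hy hz =>
      simp only [map_add, LinearMap.comp_add, LinearMap.lTensor_add, LinearMap.add_apply,
        hy, hz]
  rw [← h2, hA.counit_comul]

/-- The coefficients of a submodule form a Yetter-Drinfeld submodule, since
`v₍₋₁₎ ⊗ a v₍₀₎ = S(a₁) (a₂ v)₍₋₁₎ a₃ ⊗ (a₂ v)₍₀₎`. -/
theorem isYDSub_coactSpan (hA : 𝓐.IsLeftHopf) (h : IsYD 𝓐 M) {N : Submodule k W}
    (hN : ∀ (a : A), ∀ v ∈ N, M.act (a ⊗ₜ v) ∈ N) : IsYDSub M (coactSpan M N) where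
  act_mem a w hw := by
    have : coactSpan M N ≤ (coactSpan M N).comap (M.act ∘ₗ TensorProduct.mk k A W a) :=
      coactSpan_le.2 fun f v hv => by
        rw [Submodule.mem_comap, ← slice_lTensor, lTensor_act_coact hA h]
        refine mem_tens_top_iff.1 ?_ f
        generalize 𝓐.comul.lTensor A (𝓐.comul a) = t
        induction t with
        | zero => simp
        | tmul a₁ s =>
          induction s with
          | zero => simp
          | tmul a₂ a₃ =>
            have hx : M.coact (M.act (a₂ ⊗ₜ v)) ∈ tens (⊤ : Submodule k A) (coactSpan M N) :=
              mem_tens_top_iff.2 fun g => slice_mem_coactSpan g (hN a₂ v hv)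
            simp only [TensorProduct.map_tmul, LinearMap.comp_apply, LinearMap.flip_apply,
              TensorProduct.mk_apply, coactMul_tmul]
            generalize M.coact (M.act (a₂ ⊗ₜ v)) = x at hx
            have hle : tens (⊤ : Submodule k A) (coactSpan M N) ≤
                (tens (⊤ : Submodule k A) (coactSpan M N)).comap
                  (𝓐.mul.rTensor W ∘ₗ (TensorProduct.assoc k A A W).symm.toLinearMap ∘ₗ
                    TensorProduct.mk k A (A ⊗[k] W) (𝓐.antipode a₁) ∘ₗ
                    (𝓐.mul ∘ₗ (TensorProduct.mk k A A).flip a₃).rTensor W) :=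
              tens_le.2 fun c _ u hu => by
                simpa using tmul_mem_tens Submodule.mem_top hu
            exact hle hx
          | add x y hx hy =>
            rw [TensorProduct.tmul_add, map_add, map_add, map_add]
            exact Submodule.add_mem _ hx hy
        | add x y hx hy =>
          rw [map_add, map_add, map_add]
          exact Submodule.add_mem _ hx hy
    exact this hw
  coact_mem w hw := by
    have : coactSpan M N ≤ (tens (⊤ : Submodule k A) (coactSpan M N)).comap M.coact :=
      coactSpan_le.2 fun f v hv => by
        rw [Submodule.mem_comap, mem_tens_top_iff]
        intro g
        rw [← slice_lTensor, ← h.coassoc]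
        -- the iterated coefficient is the coefficient at the convolution product of `f` and `g`
        have key : ∀ x : A ⊗[k] W,
            slice g (slice f (TensorProduct.assoc k A A W (𝓐.comul.rTensor W x))) =
            slice ((LinearMap.mul' k k) ∘ₗ TensorProduct.map f g ∘ₗ 𝓐.comul) x := by
          intro x
          induction x with
          | zero => simp
          | tmul c u =>
            simp only [LinearMap.rTensor_tmul, slice_tmul, LinearMap.comp_apply]
            generalize 𝓐.comul c = t
            induction t with
            | zero => simp
            | tmul a b => simp [mul_smul]
            | add x y hx hy => simp only [TensorProduct.add_tmul, map_add, hx, hy, add_smul]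
          | add x y hx hy => simp only [map_add, hx, hy]
        rw [key]
        exact slice_mem_coactSpan _ hv
    exact this hw

end Generation

/-! ### Graded Yetter-Drinfeld modules -/

section GradedModules

variable {k A W : Type*} [Field k] [AddCommGroup A] [Module k A] [AddCommGroup W] [Module k W]

/-- A `ℤ`-graded Yetter-Drinfeld module `W` over an `ℕ`-graded Hopf algebra `A`, with both
gradings given by their families of projections `e` and `q`. That a structure map has degree zero
is expressed by an identity between its composites with these projections. -/
structure IsGradedYDFamily (𝓐 : HopfMaps k A) (M : ActCoact k A W) (e : ℕ → A →ₗ[k] A)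
    (q : ℤ → W →ₗ[k] W) : Prop where
  isYD : IsYD 𝓐 M
  left : IsComponentFamily e
  right : IsComponentFamily q
  act : ∀ (n : ℕ) (m : ℤ) (a : A) (w : W), q (n + m) (M.act (e n a ⊗ₜ w)) = M.act (e n a ⊗ₜ q m w)
  coact : ∀ (n : ℕ) (m : ℤ) (w : W), TensorProduct.map (e n) (q m) (M.coact w) =
    (e n).rTensor W (M.coact (q (n + m) w))
  mul : ∀ i j a b, e (i + j) (𝓐.mul (e i a ⊗ₜ e j b)) = 𝓐.mul (e i a ⊗ₜ e j b)
  comul : ∀ i j a, TensorProduct.map (e i) (e j) (𝓐.comul a) =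
    TensorProduct.map (e i) (e j) (𝓐.comul (e (i + j) a))

/-- The elements of degree `m` whose coaction has only its component in `A(0) ⊗ W`. -/
def lowVec (M : ActCoact k A W) (e : ℕ → A →ₗ[k] A) (q : ℤ → W →ₗ[k] W) (m : ℤ) :
    Submodule k W where
  carrier := {w | q m w = w ∧ ∀ j, 0 < j → (e j).rTensor W (M.coact w) = 0}
  zero_mem' := by simp
  add_mem' := fun ha hb => by
    refine ⟨by rw [map_add, ha.1, hb.1], fun j hj => ?_⟩
    rw [map_add, map_add, ha.2 j hj, hb.2 j hj, add_zero]
  smul_mem' := fun c w hw => by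
    refine ⟨by rw [map_smul, hw.1], fun j hj => ?_⟩
    rw [map_smul, map_smul, hw.2 j hj, smul_zero]

/-- The elements of degree `m` which are killed by all `A(j)` with `j > 0`. -/
def highVec (M : ActCoact k A W) (e : ℕ → A →ₗ[k] A) (q : ℤ → W →ₗ[k] W) (m : ℤ) :
    Submodule k W where
  carrier := {w | q m w = w ∧ ∀ j, 0 < j → ∀ a, M.act (e j a ⊗ₜ w) = 0}
  zero_mem' := by simp
  add_mem' := fun ha hb => by
    refine ⟨by rw [map_add, ha.1, hb.1], fun j hj a => ?_⟩
    rw [TensorProduct.tmul_add, map_add, ha.2 j hj, hb.2 j hj, add_zero]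
  smul_mem' := fun c w hw => by
    refine ⟨by rw [map_smul, hw.1], fun j hj a => ?_⟩
    rw [TensorProduct.tmul_smul, map_smul, hw.2 j hj, smul_zero]

namespace IsGradedYDFamily

variable {𝓐 : HopfMaps k A} {M : ActCoact k A W} {e : ℕ → A →ₗ[k] A} {q : ℤ → W →ₗ[k] W}
  (h : IsGradedYDFamily 𝓐 M e q)
include h

theorem proj_act {n : ℕ} {m i : ℤ} (a : A) {w : W} (hw : q m w = w) :
    q i (M.act (e n a ⊗ₜ w)) = if i = n + m then M.act (e n a ⊗ₜ w) else 0 := by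
  rw [← hw, ← h.act, h.right.orth]

theorem proj_slice {n : ℕ} {m i : ℤ} (f : A →ₗ[k] k) {w : W} (hw : q m w = w) :
    q i (slice (f ∘ₗ e n) (M.coact w)) =
      if n + i = m then slice (f ∘ₗ e n) (M.coact w) else 0 := by
  have : q i (slice (f ∘ₗ e n) (M.coact w)) = slice (f ∘ₗ e n) (M.coact (q (n + i) w)) := by
    rw [← slice_rTensor, ← slice_lTensor, ← slice_rTensor f (e n), ← h.coact,
      ← LinearMap.lTensor_comp_rTensor, LinearMap.comp_apply]
  rw [this]
  nth_rw 1 [← hw]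
  rw [h.right.orth, hw]
  split_ifs <;> simp

/-- It suffices to test the action on homogeneous elements of `A`. -/
theorem act_mem {N : Submodule k W} {w : W} (hw : ∀ n a, M.act (e n a ⊗ₜ w) ∈ N) (a : A) :
    M.act (a ⊗ₜ w) ∈ N :=
  h.left.mem (N := N.comap (M.act ∘ₗ (TensorProduct.mk k A W).flip w)) fun n => hw n a

/-- It suffices to test coefficients at homogeneous functionals on `A`. -/
theorem slice_mem {N : Submodule k W} {x : A ⊗[k] W}
    (hx : ∀ n, ∀ f : A →ₗ[k] k, slice (f ∘ₗ e n) x ∈ N) (f : A →ₗ[k] k) : slice f x ∈ N :=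
  h.left.rTensor.mem (N := N.comap (slice f)) fun n => by
    rw [Submodule.mem_comap, slice_rTensor]
    exact hx n f

theorem proj_mem_actSpan {N : Submodule k W} {m : ℤ} (hN : ∀ v ∈ N, q m v = v) (i : ℤ) :
    ∀ w ∈ actSpan M N, q i w ∈ actSpan M N := by
  have : actSpan M N ≤ (actSpan M N).comap (q i) := actSpan_le.2 fun a v hv =>
    h.act_mem (fun n a => by
      rw [Submodule.mem_comap, h.proj_act a (hN v hv)]
      split_ifs
      · exact act_mem_actSpan _ hv
      · exact Submodule.zero_mem _) a
  exact this

theorem proj_mem_coactSpan {N : Submodule k W} {m : ℤ} (hN : ∀ v ∈ N, q m v = v) (i : ℤ) :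
    ∀ w ∈ coactSpan M N, q i w ∈ coactSpan M N := by
  have : coactSpan M N ≤ (coactSpan M N).comap (q i) := coactSpan_le.2 fun f v hv =>
    h.slice_mem (fun n f => by
      rw [Submodule.mem_comap, h.proj_slice f (hN v hv)]
      split_ifs
      · exact slice_mem_coactSpan _ hv
      · exact Submodule.zero_mem _) f
  exact this

variable (hirr : ∀ N : Submodule k W, IsYDSub M N → (∀ i, ∀ v ∈ N, q i v ∈ N) → N = ⊥ ∨ N = ⊤)
include hirr

theorem actSpan_eq_top {N : Submodule k W} {m : ℤ} (hN : ∀ v ∈ N, q m v = v) (hN0 : N ≠ ⊥)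
    (hco : ∀ v ∈ N, M.coact v ∈ tens (⊤ : Submodule k A) N) : actSpan M N = ⊤ :=
  (hirr _ (isYDSub_actSpan h.isYD hco) (h.proj_mem_actSpan hN)).resolve_left fun h0 =>
    hN0 (le_bot_iff.1 (h0 ▸ le_actSpan h.isYD N))

theorem coactSpan_eq_top (hA : 𝓐.IsLeftHopf) {N : Submodule k W} {m : ℤ}
    (hN : ∀ v ∈ N, q m v = v) (hN0 : N ≠ ⊥) (hact : ∀ (a : A), ∀ v ∈ N, M.act (a ⊗ₜ v) ∈ N) :
    coactSpan M N = ⊤ :=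
  (hirr _ (isYDSub_coactSpan hA h.isYD hact) (h.proj_mem_coactSpan hN)).resolve_left fun h0 =>
    hN0 (le_bot_iff.1 (h0 ▸ le_coactSpan h.isYD N))

/-- A nonzero subcomodule of `W(m)` generates `W`, so nothing lives in lower degrees. -/
theorem proj_eq_zero_of_lt {N : Submodule k W} {m : ℤ} (hN : ∀ v ∈ N, q m v = v) (hN0 : N ≠ ⊥)
    (hco : ∀ v ∈ N, M.coact v ∈ tens (⊤ : Submodule k A) N) {i : ℤ} (hi : i < m) (w : W) :
    q i w = 0 := by
  have : actSpan M N ≤ LinearMap.ker (q i) := actSpan_le.2 fun a v hv =>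
    h.act_mem (fun n a => by
      rw [LinearMap.mem_ker, h.proj_act a (hN v hv), if_neg (by omega)]) a
  rw [h.actSpan_eq_top hirr hN hN0 hco] at this
  exact this trivial

/-- If a nonzero subcomodule of `W(m)` is stable under `A(0)`, then it is all of `W(m)`. -/
theorem proj_mem_of_subcomodule {N : Submodule k W} {m : ℤ} (hN : ∀ v ∈ N, q m v = v)
    (hN0 : N ≠ ⊥) (hco : ∀ v ∈ N, M.coact v ∈ tens (⊤ : Submodule k A) N)
    (hact : ∀ (a : A), ∀ v ∈ N, M.act (e 0 a ⊗ₜ v) ∈ N) (w : W) : q m w ∈ N := by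
  have : actSpan M N ≤ N.comap (q m) := actSpan_le.2 fun a v hv =>
    h.act_mem (fun n a => by
      rw [Submodule.mem_comap, h.proj_act a (hN v hv)]
      split_ifs with hn
      · obtain rfl : n = 0 := by omega
        exact hact a v hv
      · exact Submodule.zero_mem _) a
  rw [h.actSpan_eq_top hirr hN hN0 hco] at this
  exact this trivial

/-- A nonzero submodule of `W(m)` cogenerates `W`, so nothing lives in higher degrees. -/
theorem proj_eq_zero_of_gt (hA : 𝓐.IsLeftHopf) {N : Submodule k W} {m : ℤ}
    (hN : ∀ v ∈ N, q m v = v) (hN0 : N ≠ ⊥) (hact : ∀ (a : A), ∀ v ∈ N, M.act (a ⊗ₜ v) ∈ N)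
    {i : ℤ} (hi : m < i) (w : W) : q i w = 0 := by
  have : coactSpan M N ≤ LinearMap.ker (q i) := coactSpan_le.2 fun f v hv =>
    h.slice_mem (fun n f => by
      rw [LinearMap.mem_ker, h.proj_slice f (hN v hv), if_neg (by omega)]) f
  rw [h.coactSpan_eq_top hirr hA hN hN0 hact] at this
  exact this trivial

/-- If a nonzero submodule of `W(m)` is stable under the projected coaction of `A(0)`, then it
is all of `W(m)`. -/
theorem proj_mem_of_submodule (hA : 𝓐.IsLeftHopf) {N : Submodule k W} {m : ℤ}
    (hN : ∀ v ∈ N, q m v = v) (hN0 : N ≠ ⊥) (hact : ∀ (a : A), ∀ v ∈ N, M.act (a ⊗ₜ v) ∈ N)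
    (hco : ∀ f : A →ₗ[k] k, ∀ v ∈ N, slice (f ∘ₗ e 0) (M.coact v) ∈ N) (w : W) : q m w ∈ N := by
  have : coactSpan M N ≤ N.comap (q m) := coactSpan_le.2 fun f v hv =>
    h.slice_mem (fun n f => by
      rw [Submodule.mem_comap, h.proj_slice f (hN v hv)]
      split_ifs with hn
      · obtain rfl : n = 0 := by omega
        exact hco f v hv
      · exact Submodule.zero_mem _) f
  rw [h.coactSpan_eq_top hirr hA hN hN0 hact] at this
  exact this trivial

omit hirr

/-- The coefficients of the component of highest `A`-degree of `δ(w)` lie in `lowVec`. -/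
theorem slice_mem_lowVec {m : ℤ} {w : W} (hw : q m w = w) {n : ℕ}
    (hn : ∀ j, n < j → (e j).rTensor W (M.coact w) = 0) (f : A →ₗ[k] k) :
    slice (f ∘ₗ e n) (M.coact w) ∈ lowVec M e q (m - n) := by
  refine ⟨by rw [h.proj_slice f hw, if_pos (by omega)], fun j hj => eq_zero_of_slice fun g => ?_⟩
  -- by coassociativity, this is the coefficient of `δ(w)` at the functional `(f ⊗ g) Δ`
  have key : ∀ x : A ⊗[k] W, slice (g ∘ₗ e j) (slice (f ∘ₗ e n)
      (TensorProduct.assoc k A A W (𝓐.comul.rTensor W x))) =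
      slice (LinearMap.mul' k k ∘ₗ TensorProduct.map f g ∘ₗ
        TensorProduct.map (e n) (e j) ∘ₗ 𝓐.comul) x := by
    intro x
    induction x with
    | zero => simp
    | tmul c u =>
      simp only [LinearMap.rTensor_tmul, slice_tmul, LinearMap.comp_apply]
      generalize 𝓐.comul c = t
      induction t with
      | zero => simp
      | tmul a b => simp [mul_smul]
      | add x y hx hy => simp only [TensorProduct.add_tmul, map_add, hx, hy, add_smul]
    | add x y hx hy => simp only [map_add, hx, hy]
  have hcomul : TensorProduct.map (e n) (e j) ∘ₗ 𝓐.comul =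
      (TensorProduct.map (e n) (e j) ∘ₗ 𝓐.comul) ∘ₗ e (n + j) :=
    LinearMap.ext fun a => h.comul n j a
  rw [slice_rTensor, ← slice_lTensor, ← h.isYD.coassoc, key, hcomul]
  simp only [← LinearMap.comp_assoc]
  rw [← slice_rTensor, hn _ (by omega), map_zero]

theorem coact_mem_lowVec {m : ℤ} : ∀ v ∈ lowVec M e q m,
    M.coact v ∈ tens (⊤ : Submodule k A) (lowVec M e q m) := fun v hv => by
  refine mem_tens_top_iff.2 (h.slice_mem fun n f => ?_)
  rcases Nat.eq_zero_or_pos n with rfl | hn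
  · simpa using h.slice_mem_lowVec hv.1 hv.2 f
  · rw [← slice_rTensor, hv.2 n hn, map_zero]
    exact Submodule.zero_mem _

theorem act_mem_highVec {m : ℤ} (a : A) : ∀ v ∈ highVec M e q m,
    M.act (a ⊗ₜ v) ∈ highVec M e q m := fun v hv => by
  refine h.act_mem (fun n a => ?_) a
  rcases Nat.eq_zero_or_pos n with rfl | hn
  · refine ⟨by rw [h.proj_act a hv.1, if_pos (by simp)], fun j hj b => ?_⟩
    rw [← h.isYD.mul_act, ← h.mul, hv.2 _ (by omega)]
  · rw [hv.2 n hn]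
    exact Submodule.zero_mem _

/-- Every nonzero `w ∈ W(m)` gives rise to a nonzero element of `lowVec`. -/
theorem exists_lowVec_ne_bot {m : ℤ} {w : W} (hw : q m w = w) (hw0 : w ≠ 0) :
    ∃ n : ℕ, (e n).rTensor W (M.coact w) ≠ 0 ∧ lowVec M e q (m - n) ≠ ⊥ := by
  classical
  obtain ⟨s, hs⟩ := (h.left.rTensor (U := W)).complete (M.coact w)
  have hne : ∃ n, (e n).rTensor W (M.coact w) ≠ 0 := by
    by_contra! h0
    have := h.isYD.counit_coact w
    rw [h.left.rTensor.eq_zero h0] at this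
    exact hw0 (by simpa using this.symm)
  have hmem : ∀ n, (e n).rTensor W (M.coact w) ≠ 0 → n ∈ s := fun n hn => by
    by_contra hns
    exact hn (h.left.rTensor.eq_zero_of_notMem hs hns)
  -- the largest degree which occurs in `δ(w)`
  let n := Nat.findGreatest (fun n => (e n).rTensor W (M.coact w) ≠ 0) (s.sup id)
  obtain ⟨n₀, hn₀⟩ := hne
  have hn : (e n).rTensor W (M.coact w) ≠ 0 :=
    Nat.findGreatest_spec (P := fun n => (e n).rTensor W (M.coact w) ≠ 0)
      (Finset.le_sup (f := id) (hmem n₀ hn₀)) hn₀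
  refine ⟨n, hn, fun hbot => hn (eq_zero_of_slice fun f => ?_)⟩
  have := h.slice_mem_lowVec hw (n := n) (fun j hj => by
    by_contra hj0
    exact Nat.findGreatest_is_greatest hj (Finset.le_sup (f := id) (hmem j hj0)) hj0) f
  rw [hbot, Submodule.mem_bot] at this
  rw [slice_rTensor, this]

/-- If `w ∈ W(m)` is nonzero and killed by `A(j)` for `j > b`, then some `A(n) w` with `n ≤ b`
contains a nonzero element of `highVec`. -/
theorem exists_highVec_ne_bot {m : ℤ} {w : W} (hw : q m w = w) (hw0 : w ≠ 0) {b : ℕ}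
    (hb : ∀ j, b < j → ∀ a, M.act (e j a ⊗ₜ w) = 0) :
    ∃ n : ℕ, n ≤ b ∧ highVec M e q (m + n) ≠ ⊥ := by
  classical
  have hne : ∃ n, ∃ a, M.act (e n a ⊗ₜ w) ≠ 0 := by
    by_contra! h0
    have : M.act (𝓐.one ⊗ₜ w) ∈ (⊥ : Submodule k W) := h.act_mem h0 _
    rw [h.isYD.one_act] at this
    exact hw0 this
  obtain ⟨n₀, hn₀⟩ := hne
  have hle : ∀ n, (∃ a, M.act (e n a ⊗ₜ w) ≠ 0) → n ≤ b := fun n ⟨a, ha⟩ => by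
    by_contra! hn
    exact ha (hb n hn a)
  -- the largest degree which acts nontrivially on `w`
  let n := Nat.findGreatest (fun n => ∃ a, M.act (e n a ⊗ₜ w) ≠ 0) b
  obtain ⟨a, ha⟩ : ∃ a, M.act (e n a ⊗ₜ w) ≠ 0 :=
    Nat.findGreatest_spec (P := fun n => ∃ a, M.act (e n a ⊗ₜ w) ≠ 0) (hle n₀ hn₀) hn₀
  refine ⟨n, Nat.findGreatest_le b, (Submodule.ne_bot_iff _).2 ⟨_, ⟨?_, fun j hj c => ?_⟩, ha⟩⟩
  · rw [h.proj_act a hw, if_pos (add_comm _ _)]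
  · rw [← h.isYD.mul_act, ← h.mul]
    by_contra hne
    have hex : ∃ a, M.act (e (j + n) a ⊗ₜ w) ≠ 0 := ⟨_, hne⟩
    exact Nat.findGreatest_is_greatest (P := fun n => ∃ a, M.act (e n a ⊗ₜ w) ≠ 0)
      (by omega : n < j + n) (hle _ hex) hex

include hirr

theorem proj_eq_zero_of_lt_lowVec {m : ℤ} (hm : lowVec M e q m ≠ ⊥) {i : ℤ} (hi : i < m)
    (w : W) : q i w = 0 :=
  h.proj_eq_zero_of_lt hirr (N := lowVec M e q m) (fun _ hv => hv.1) hm h.coact_mem_lowVec hi w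

theorem proj_eq_zero_of_gt_highVec (hA : 𝓐.IsLeftHopf) {m : ℤ} (hm : highVec M e q m ≠ ⊥)
    {i : ℤ} (hi : m < i) (w : W) : q i w = 0 :=
  h.proj_eq_zero_of_gt hirr hA (N := highVec M e q m) (fun _ hv => hv.1) hm h.act_mem_highVec hi w

end IsGradedYDFamily

end GradedModules

/-! ### The Hopf algebra axioms of the bosonization -/

theorem interchange_tmul {k A B A' B' X Y : Type*} [Field k] [AddCommGroup A] [Module k A]
    [AddCommGroup B] [Module k B] [AddCommGroup A'] [Module k A'] [AddCommGroup B'] [Module k B']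
    [AddCommGroup X] [Module k X] [AddCommGroup Y] [Module k Y]
    (t : B ⊗[k] A' →ₗ[k] X ⊗[k] Y) (a : A) (b : B) (a' : A') (b' : B') :
    interchange t ((a ⊗ₜ b) ⊗ₜ (a' ⊗ₜ b')) =
      TensorProduct.map (TensorProduct.mk k A X a) ((TensorProduct.mk k Y B').flip b')
        (t (b ⊗ₜ a')) := by
  simp only [interchange, LinearMap.comp_apply, LinearEquiv.coe_coe, TensorProduct.assoc_tmul,
    TensorProduct.assoc_symm_tmul, LinearMap.lTensor_tmul, LinearMap.rTensor_tmul]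
  generalize t (b ⊗ₜ a') = x
  induction x with
  | zero => simp
  | tmul x y => simp
  | add x y hx hy => simp only [TensorProduct.tmul_add, TensorProduct.add_tmul, map_add, hx, hy]

section Hopf

variable {k H R : Type*} [Field k] [Ring H] [HopfAlgebra k H]

theorem smashSwap_tmul {V : Type*} [AddCommGroup V] [Module k V] (M : ActCoact k H V)
    (h : H) (v : V) :
    smashSwap (HopfMaps.ofHopfAlgebra k H) M (h ⊗ₜ v) =
      (M.act ∘ₗ (TensorProduct.mk k H V).flip v).rTensor H (Coalgebra.comul h) := by
  have : ∀ t : H ⊗[k] H, M.act.rTensor H (TensorProduct.rightComm k H H V (t ⊗ₜ v)) =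
      (M.act ∘ₗ (TensorProduct.mk k H V).flip v).rTensor H t := by
    intro t
    induction t with
    | zero => simp
    | tmul a b => simp
    | add x y hx hy => simp only [TensorProduct.add_tmul, map_add, hx, hy]
  exact this _

theorem cosmashSwap_tmul {V : Type*} [AddCommGroup V] [Module k V] (M : ActCoact k H V) (v : V)
    (h : H) : cosmashSwap (HopfMaps.ofHopfAlgebra k H) M (v ⊗ₜ h) =
      (LinearMap.mulRight k h).rTensor V (M.coact v) := by
  have : ∀ t : H ⊗[k] V,
      (LinearMap.mul' k H).rTensor V (TensorProduct.rightComm k H V H (t ⊗ₜ h)) =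
      (LinearMap.mulRight k h).rTensor V t := by
    intro t
    induction t with
    | zero => simp
    | tmul a b => simp
    | add x y hx hy => simp only [TensorProduct.add_tmul, map_add, hx, hy]
  exact this _

variable {V V' : Type*} [AddCommGroup V] [Module k V] [AddCommGroup V'] [Module k V']

theorem smash_mul_tmul (𝓥 : HopfMaps k V) (M : ActCoact k H V) (r s : V) (h g : H) :
    (bosonization (HopfMaps.ofHopfAlgebra k H) 𝓥 M).mul ((r ⊗ₜ h) ⊗ₜ (s ⊗ₜ g)) =
      TensorProduct.map
        (𝓥.mul ∘ₗ TensorProduct.mk k V V r ∘ₗ M.act ∘ₗ (TensorProduct.mk k H V).flip s)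
        (LinearMap.mulRight k g) (Coalgebra.comul h) := by
  have : ∀ t : H ⊗[k] H, TensorProduct.map 𝓥.mul (LinearMap.mul' k H)
      (TensorProduct.map (TensorProduct.mk k V V r) ((TensorProduct.mk k H H).flip g)
        ((M.act ∘ₗ (TensorProduct.mk k H V).flip s).rTensor H t)) =
      TensorProduct.map
        (𝓥.mul ∘ₗ TensorProduct.mk k V V r ∘ₗ M.act ∘ₗ (TensorProduct.mk k H V).flip s)
        (LinearMap.mulRight k g) t := by
    intro t
    induction t with
    | zero => simp
    | tmul a b => simp
    | add x y hx hy => simp only [map_add, hx, hy]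
  rw [← this, ← smashSwap_tmul, ← interchange_tmul]
  rfl

/-- `((r¹ ⊗ r²) ⊗ (h₁ ⊗ h₂)) ↦ (r¹ # (r²)₍₋₁₎ h₁) ⊗ ((r²)₍₀₎ # h₂)`. -/
noncomputable def cosmash (M : ActCoact k H V) :
    (V ⊗[k] V) ⊗[k] (H ⊗[k] H) →ₗ[k] (V ⊗[k] H) ⊗[k] (V ⊗[k] H) :=
  interchange (cosmashSwap (HopfMaps.ofHopfAlgebra k H) M)

theorem cosmash_tmul (M : ActCoact k H V) (r s : V) (h g : H) :
    cosmash M ((r ⊗ₜ s) ⊗ₜ (h ⊗ₜ g)) =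
      TensorProduct.map (TensorProduct.mk k V H r ∘ₗ LinearMap.mulRight k h)
        ((TensorProduct.mk k V H).flip g) (M.coact s) := by
  rw [cosmash, interchange_tmul, cosmashSwap_tmul, ← LinearMap.comp_apply,
    LinearMap.map_comp_rTensor]

theorem smash_comul_tmul (𝓥 : HopfMaps k V) (M : ActCoact k H V) (r : V) (h : H) :
    (bosonization (HopfMaps.ofHopfAlgebra k H) 𝓥 M).comul (r ⊗ₜ h) =
      cosmash M (𝓥.comul r ⊗ₜ Coalgebra.comul h) := rfl

theorem smash_antipode_tmul (𝓥 : HopfMaps k V) (M : ActCoact k H V) (r : V) (h : H) :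
    (bosonization (HopfMaps.ofHopfAlgebra k H) 𝓥 M).antipode (r ⊗ₜ h) =
      (bosonization (HopfMaps.ofHopfAlgebra k H) 𝓥 M).mul (TensorProduct.map
        (TensorProduct.mk k V H 𝓥.one ∘ₗ HopfAlgebra.antipode k ∘ₗ LinearMap.mulRight k h)
        ((TensorProduct.mk k V H).flip 1 ∘ₗ 𝓥.antipode) (M.coact r)) := by
  have : (bosonization (HopfMaps.ofHopfAlgebra k H) 𝓥 M).antipode (r ⊗ₜ h) =
      (bosonization (HopfMaps.ofHopfAlgebra k H) 𝓥 M).mul (TensorProduct.map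
        (TensorProduct.mk k V H 𝓥.one ∘ₗ HopfAlgebra.antipode k)
        ((TensorProduct.mk k V H).flip 1 ∘ₗ 𝓥.antipode)
        (cosmashSwap (HopfMaps.ofHopfAlgebra k H) M (r ⊗ₜ h))) := rfl
  rw [this, cosmashSwap_tmul]
  congr 1
  exact LinearMap.congr_fun (LinearMap.map_comp_rTensor _ _ _ _) _

theorem map_cosmash {M : ActCoact k H V} {M' : ActCoact k H V'} (f g : V →ₗ[k] V')
    (hg : ∀ v, M'.coact (g v) = g.lTensor H (M.coact v)) (t : V ⊗[k] V) (p : H ⊗[k] H) :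
    TensorProduct.map (f.rTensor H) (g.rTensor H) (cosmash M (t ⊗ₜ p)) =
      cosmash M' (TensorProduct.map f g t ⊗ₜ p) := by
  induction t with
  | zero => simp only [TensorProduct.zero_tmul, map_zero]
  | add x y hx hy => simp only [TensorProduct.add_tmul, map_add, hx, hy]
  | tmul r s =>
  induction p with
  | zero => simp only [TensorProduct.tmul_zero, map_zero]
  | add x y hx hy => simp only [TensorProduct.tmul_add, map_add, hx, hy]
  | tmul h₁ h₂ =>
    rw [cosmash_tmul, TensorProduct.map_tmul, cosmash_tmul, hg]
    generalize M.coact s = x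
    induction x with
    | zero => simp only [map_zero]
    | add x y hx hy => simp only [map_add, hx, hy]
    | tmul c u => simp

/-- A linear map which preserves all structure maps of a braided Hopf algebra. -/
structure IsBraidedHom (𝓥 : HopfMaps k V) (M : ActCoact k H V) (𝓥' : HopfMaps k V')
    (M' : ActCoact k H V') (f : V →ₗ[k] V') : Prop extends IsYDHom M M' f where
  map_mul : ∀ v u, f (𝓥.mul (v ⊗ₜ u)) = 𝓥'.mul (f v ⊗ₜ f u)
  map_one : f 𝓥.one = 𝓥'.one
  map_comul : ∀ v, TensorProduct.map f f (𝓥.comul v) = 𝓥'.comul (f v)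
  map_counit : ∀ v, 𝓥'.counit (f v) = 𝓥.counit v
  map_antipode : ∀ v, f (𝓥.antipode v) = 𝓥'.antipode (f v)

namespace IsBraidedHom

variable {𝓥 : HopfMaps k V} {M : ActCoact k H V} {𝓥' : HopfMaps k V'} {M' : ActCoact k H V'}
  {f : V →ₗ[k] V'} (hf : IsBraidedHom 𝓥 M 𝓥' M' f)
include hf

theorem bosonization_mul (a b : V ⊗[k] H) :
    f.rTensor H ((bosonization (HopfMaps.ofHopfAlgebra k H) 𝓥 M).mul (a ⊗ₜ b)) =
      (bosonization (HopfMaps.ofHopfAlgebra k H) 𝓥' M').mul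
        (f.rTensor H a ⊗ₜ f.rTensor H b) := by
  induction a with
  | zero => simp only [TensorProduct.zero_tmul, map_zero]
  | add x y hx hy => simp only [TensorProduct.add_tmul, map_add, hx, hy]
  | tmul r h =>
  induction b with
  | zero => simp only [TensorProduct.tmul_zero, map_zero]
  | add x y hx hy => simp only [TensorProduct.tmul_add, map_add, hx, hy]
  | tmul s g =>
    rw [LinearMap.rTensor_tmul, LinearMap.rTensor_tmul, smash_mul_tmul, smash_mul_tmul]
    generalize Coalgebra.comul (R := k) h = t
    induction t with
    | zero => simp only [map_zero]
    | add x y hx hy => simp only [map_add, hx, hy]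
    | tmul x y => simp [hf.map_mul, hf.map_act]

theorem bosonization_comul (a : V ⊗[k] H) :
    TensorProduct.map (f.rTensor H) (f.rTensor H)
      ((bosonization (HopfMaps.ofHopfAlgebra k H) 𝓥 M).comul a) =
      (bosonization (HopfMaps.ofHopfAlgebra k H) 𝓥' M').comul (f.rTensor H a) := by
  induction a with
  | zero => simp only [map_zero]
  | add x y hx hy => simp only [map_add, hx, hy]
  | tmul r h =>
    rw [LinearMap.rTensor_tmul, smash_comul_tmul, smash_comul_tmul, map_cosmash f f hf.map_coact,
      hf.map_comul]

theorem bosonization_counit (a : V ⊗[k] H) :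
    (bosonization (HopfMaps.ofHopfAlgebra k H) 𝓥' M').counit (f.rTensor H a) =
      (bosonization (HopfMaps.ofHopfAlgebra k H) 𝓥 M).counit a := by
  induction a with
  | zero => simp only [map_zero]
  | add x y hx hy => simp only [map_add, hx, hy]
  | tmul r h => simp [bosonization, hf.map_counit]

theorem bosonization_antipode (a : V ⊗[k] H) :
    f.rTensor H ((bosonization (HopfMaps.ofHopfAlgebra k H) 𝓥 M).antipode a) =
      (bosonization (HopfMaps.ofHopfAlgebra k H) 𝓥' M').antipode (f.rTensor H a) := by
  induction a with
  | zero => simp only [map_zero]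
  | add x y hx hy => simp only [map_add, hx, hy]
  | tmul r h =>
    rw [LinearMap.rTensor_tmul, smash_antipode_tmul, smash_antipode_tmul, hf.map_coact]
    generalize M.coact r = x
    induction x with
    | zero => simp only [map_zero]
    | add x y hx hy => simp only [map_add, hx, hy]
    | tmul c u => simp [hf.bosonization_mul, hf.map_one, hf.map_antipode]

end IsBraidedHom

variable [Ring R] [Algebra k R] [Coalgebra k R] (𝓡 : YDHopfAlgebra k H R)

theorem bosonization_one : 𝓡.bosonization.one = (1 : R) ⊗ₜ[k] (1 : H) := rfl

theorem bosonization_mul_tmul (r s : R) (h g : H) :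
    𝓡.bosonization.mul ((r ⊗ₜ h) ⊗ₜ (s ⊗ₜ g)) =
      TensorProduct.map (LinearMap.mulLeft k r ∘ₗ 𝓡.act ∘ₗ (TensorProduct.mk k H R).flip s)
        (LinearMap.mulRight k g) (Coalgebra.comul h) :=
  smash_mul_tmul 𝓡.hopfMaps 𝓡.toActCoact r s h g

theorem bosonization_comul_tmul (r : R) (h : H) : 𝓡.bosonization.comul (r ⊗ₜ h) =
    cosmash 𝓡.toActCoact (Coalgebra.comul r ⊗ₜ Coalgebra.comul h) := rfl

theorem bosonization_counit_tmul (r : R) (h : H) : 𝓡.bosonization.counit (r ⊗ₜ h) =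
    Coalgebra.counit (R := k) r * Coalgebra.counit (R := k) h := rfl

theorem bosonization_antipode_tmul (r : R) (h : H) : 𝓡.bosonization.antipode (r ⊗ₜ h) =
    𝓡.bosonization.mul (TensorProduct.map
      (TensorProduct.mk k R H 1 ∘ₗ HopfAlgebra.antipode k ∘ₗ LinearMap.mulRight k h)
      ((TensorProduct.mk k R H).flip 1 ∘ₗ 𝓡.antipode) (𝓡.coact r)) :=
  smash_antipode_tmul 𝓡.hopfMaps 𝓡.toActCoact r h

theorem act_one_left (r : R) : 𝓡.act (1 ⊗ₜ r) = r := 𝓡.isYD.one_act r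

theorem act_mul_left (h g : H) (r : R) : 𝓡.act ((h * g) ⊗ₜ r) = 𝓡.act (h ⊗ₜ 𝓡.act (g ⊗ₜ r)) :=
  𝓡.isYD.mul_act h g r

theorem act_one (h : H) : 𝓡.act (h ⊗ₜ 1) = Coalgebra.counit (R := k) h • (1 : R) := by
  have := 𝓡.unit_hom.map_act h 1
  simp only [ActCoact.unitObject, LinearMap.comp_apply, LinearEquiv.coe_coe,
    LinearMap.rTensor_tmul, TensorProduct.lid_tmul, Algebra.linearMap_apply, map_one] at this
  rw [← this, smul_eq_mul, mul_one, Algebra.algebraMap_eq_smul_one]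
  rfl

theorem act_mul (h : H) (r s : R) : 𝓡.act (h ⊗ₜ (r * s)) =
    LinearMap.mul' k R (TensorProduct.map (𝓡.act ∘ₗ (TensorProduct.mk k H R).flip r)
      (𝓡.act ∘ₗ (TensorProduct.mk k H R).flip s) (Coalgebra.comul h)) := by
  have h1 := 𝓡.mul_hom.map_act h (r ⊗ₜ s)
  rw [LinearMap.mul'_apply] at h1
  rw [← h1]
  have : ∀ t : H ⊗[k] H, TensorProduct.map 𝓡.act 𝓡.act
      (TensorProduct.tensorTensorTensorComm k H H R R (t ⊗ₜ (r ⊗ₜ s))) =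
      TensorProduct.map (𝓡.act ∘ₗ (TensorProduct.mk k H R).flip r)
        (𝓡.act ∘ₗ (TensorProduct.mk k H R).flip s) t := by
    intro t
    induction t with
    | zero => simp
    | tmul a b => simp
    | add x y hx hy => simp only [TensorProduct.add_tmul, map_add, hx, hy]
  rw [← this]
  rfl

theorem bosonization_one_mul (a : R ⊗[k] H) : 𝓡.bosonization.mul (𝓡.bosonization.one ⊗ₜ a) = a := by
  induction a with
  | zero => simp
  | tmul r h =>
    rw [bosonization_one, bosonization_mul_tmul, Bialgebra.comul_one,
      Algebra.TensorProduct.one_def]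
    simp [act_one_left]
  | add x y hx hy => rw [TensorProduct.tmul_add, map_add, hx, hy]

theorem bosonization_mul_one (a : R ⊗[k] H) : 𝓡.bosonization.mul (a ⊗ₜ 𝓡.bosonization.one) = a := by
  induction a with
  | zero => simp
  | tmul r h =>
    rw [bosonization_one, bosonization_mul_tmul]
    have : ∀ t : H ⊗[k] H,
        TensorProduct.map (LinearMap.mulLeft k r ∘ₗ 𝓡.act ∘ₗ (TensorProduct.mk k H R).flip 1)
          (LinearMap.mulRight k 1) t =
        r ⊗ₜ TensorProduct.lid k H ((Coalgebra.counit (R := k) (A := H)).rTensor H t) := by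
      intro t
      induction t with
      | zero => simp
      | tmul a b => simp [act_one, TensorProduct.smul_tmul]
      | add x y hx hy => simp only [map_add, hx, hy, TensorProduct.tmul_add]
    rw [this, Coalgebra.rTensor_counit_comul]
    simp
  | add x y hx hy => rw [TensorProduct.add_tmul, map_add, hx, hy]

theorem bosonization_mul_assoc (a b c : R ⊗[k] H) :
    𝓡.bosonization.mul (𝓡.bosonization.mul (a ⊗ₜ b) ⊗ₜ c) =
      𝓡.bosonization.mul (a ⊗ₜ 𝓡.bosonization.mul (b ⊗ₜ c)) := by
  induction a with
  | zero => simp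
  | add x y hx hy => simp only [TensorProduct.add_tmul, map_add, hx, hy]
  | tmul r h =>
  induction b with
  | zero => simp
  | add x y hx hy => simp only [TensorProduct.add_tmul, TensorProduct.tmul_add, map_add, hx, hy]
  | tmul s g =>
  induction c with
  | zero => simp
  | add x y hx hy => simp only [TensorProduct.tmul_add, map_add, hx, hy]
  | tmul u f =>
  -- `K (g₁ ⊗ g₂) (h₁ ⊗ (h₂ ⊗ h₃)) = r (h₁ • s) (h₂ g₁ • u) # h₃ g₂ f`
  let K : H ⊗[k] H → H ⊗[k] (H ⊗[k] H) →ₗ[k] R ⊗[k] H := fun p =>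
    (LinearMap.mul' k R).rTensor H ∘ₗ (TensorProduct.assoc k R R H).symm.toLinearMap ∘ₗ
      TensorProduct.map (LinearMap.mulLeft k r ∘ₗ 𝓡.act ∘ₗ (TensorProduct.mk k H R).flip s)
        (TensorProduct.map (𝓡.act ∘ₗ (TensorProduct.mk k H R).flip u) (LinearMap.mulRight k f) ∘ₗ
          LinearMap.mulRight k p)
  have hK : ∀ (p : H ⊗[k] H) (x : H) (y : H ⊗[k] H), K p (x ⊗ₜ y) =
      (LinearMap.mulLeft k (r * 𝓡.act (x ⊗ₜ s))).rTensor H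
        (TensorProduct.map (𝓡.act ∘ₗ (TensorProduct.mk k H R).flip u) (LinearMap.mulRight k f)
          (y * p)) := by
    intro p x y
    simp only [K, LinearMap.comp_apply, TensorProduct.map_tmul, LinearMap.mulRight_apply]
    generalize TensorProduct.map (𝓡.act ∘ₗ (TensorProduct.mk k H R).flip u)
      (LinearMap.mulRight k f) (y * p) = z
    induction z with
    | zero => simp
    | tmul a b => simp [mul_assoc]
    | add x y hx hy => simp only [TensorProduct.tmul_add, map_add, hx, hy]
  have hL : ∀ t : H ⊗[k] H, 𝓡.bosonization.mul
      (TensorProduct.map (LinearMap.mulLeft k r ∘ₗ 𝓡.act ∘ₗ (TensorProduct.mk k H R).flip s)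
        (LinearMap.mulRight k g) t ⊗ₜ (u ⊗ₜ f)) =
      K (Coalgebra.comul g) ((Coalgebra.comul (R := k) (A := H)).lTensor H t) := by
    intro t
    induction t with
    | zero => simp
    | tmul x y =>
      rw [LinearMap.lTensor_tmul, hK, ← Bialgebra.comul_mul, TensorProduct.map_tmul,
        bosonization_mul_tmul, LinearMap.mulRight_apply]
      exact (LinearMap.congr_fun (LinearMap.rTensor_comp_map _ _ _ _) _).symm
    | add x y hx hy => simp only [TensorProduct.add_tmul, map_add, hx, hy]
  have hR : ∀ p : H ⊗[k] H, 𝓡.bosonization.mul ((r ⊗ₜ h) ⊗ₜ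
      (TensorProduct.map (LinearMap.mulLeft k s ∘ₗ 𝓡.act ∘ₗ (TensorProduct.mk k H R).flip u)
        (LinearMap.mulRight k f) p)) =
      K p ((Coalgebra.comul (R := k) (A := H)).lTensor H (Coalgebra.comul h)) := by
    intro p
    rw [← Coalgebra.coassoc_apply]
    induction p with
    | zero => simp [K]
    | tmul g₁ g₂ =>
      rw [TensorProduct.map_tmul, bosonization_mul_tmul]
      generalize Coalgebra.comul (R := k) h = t
      induction t with
      | zero => simp
      | tmul x y =>
        simp only [TensorProduct.map_tmul, LinearMap.comp_apply, LinearMap.flip_apply,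
          TensorProduct.mk_apply, LinearMap.mulLeft_apply, LinearMap.rTensor_tmul, act_mul]
        generalize Coalgebra.comul (R := k) x = z
        induction z with
        | zero => simp
        | tmul z₁ z₂ => simp [hK, act_mul_left, mul_assoc]
        | add x y hx hy => simp only [TensorProduct.add_tmul, mul_add, map_add, hx, hy]
      | add x y hx hy => simp only [map_add, hx, hy]
    | add x y hx hy =>
      have : K (x + y) = K x + K y := by
        ext
        simp [hK, mul_add]
      simp only [TensorProduct.tmul_add, map_add, hx, hy, this, LinearMap.add_apply]
  rw [bosonization_mul_tmul, bosonization_mul_tmul, hL, hR]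

theorem coact_comul (r : R) :
    (ActCoact.tensor (HopfMaps.ofHopfAlgebra k H) 𝓡.toActCoact 𝓡.toActCoact).coact
      (Coalgebra.comul r) = (Coalgebra.comul (R := k) (A := R)).lTensor H (𝓡.coact r) :=
  𝓡.comul_hom.map_coact r

theorem lTensor_counit_coact (r : R) :
    (Coalgebra.counit (R := k) (A := R)).lTensor H (𝓡.coact r) =
      1 ⊗ₜ Coalgebra.counit (R := k) r :=
  (𝓡.counit_hom.map_coact r).symm

theorem tensor_coact_tmul (r s : R) :
    (ActCoact.tensor (HopfMaps.ofHopfAlgebra k H) 𝓡.toActCoact 𝓡.toActCoact).coact (r ⊗ₜ s) =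
      (LinearMap.mul' k H).rTensor (R ⊗[k] R)
        (TensorProduct.tensorTensorTensorComm k H R H R (𝓡.coact r ⊗ₜ 𝓡.coact s)) := rfl

theorem bosonization_counit_comul (a : R ⊗[k] H) : TensorProduct.lid k (R ⊗[k] H)
    (𝓡.bosonization.counit.rTensor (R ⊗[k] H) (𝓡.bosonization.comul a)) = a := by
  induction a with
  | zero => simp
  | add x y hx hy => simp only [map_add, hx, hy]
  | tmul r h =>
    rw [bosonization_comul_tmul]
    have key : ∀ (t : R ⊗[k] R) (p : H ⊗[k] H), TensorProduct.lid k (R ⊗[k] H)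
        (𝓡.bosonization.counit.rTensor (R ⊗[k] H) (cosmash 𝓡.toActCoact (t ⊗ₜ p))) =
        TensorProduct.lid k R ((Coalgebra.counit (R := k) (A := R)).rTensor R t) ⊗ₜ
          TensorProduct.lid k H ((Coalgebra.counit (R := k) (A := H)).rTensor H p) := by
      intro t p
      induction t with
      | zero => simp
      | add x y hx hy => simp only [TensorProduct.add_tmul, map_add, hx, hy]
      | tmul r₁ r₂ =>
      induction p with
      | zero => simp
      | add x y hx hy => simp only [TensorProduct.tmul_add, map_add, hx, hy]
      | tmul h₁ h₂ =>
        rw [cosmash_tmul]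
        have : ∀ x : H ⊗[k] R, TensorProduct.lid k (R ⊗[k] H)
            (𝓡.bosonization.counit.rTensor (R ⊗[k] H)
              (TensorProduct.map (TensorProduct.mk k R H r₁ ∘ₗ LinearMap.mulRight k h₁)
                ((TensorProduct.mk k R H).flip h₂) x)) =
            (Coalgebra.counit (R := k) r₁ * Coalgebra.counit (R := k) h₁) •
              (TensorProduct.lid k R ((Coalgebra.counit (R := k) (A := H)).rTensor R x) ⊗ₜ h₂) := by
          intro x
          induction x with
          | zero => simp
          | add x y hx hy => simp only [TensorProduct.add_tmul, map_add, hx, hy, smul_add]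
          | tmul c u =>
            simp only [TensorProduct.map_tmul, LinearMap.comp_apply, LinearMap.mulRight_apply,
              TensorProduct.mk_apply, LinearMap.rTensor_tmul, LinearMap.flip_apply,
              TensorProduct.lid_tmul, bosonization_counit_tmul, Bialgebra.counit_mul,
              ← TensorProduct.smul_tmul', smul_smul]
            congr 1
            ring
        rw [this]
        have h1 : TensorProduct.lid k R
            ((Coalgebra.counit (R := k) (A := H)).rTensor R (𝓡.coact r₂)) = r₂ :=
          𝓡.isYD.counit_coact r₂
        rw [h1]
        simp only [LinearMap.rTensor_tmul, TensorProduct.lid_tmul, TensorProduct.smul_tmul_smul]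
    rw [key, Coalgebra.rTensor_counit_comul, Coalgebra.rTensor_counit_comul]
    simp

theorem bosonization_comul_counit (a : R ⊗[k] H) : TensorProduct.rid k (R ⊗[k] H)
    (𝓡.bosonization.counit.lTensor (R ⊗[k] H) (𝓡.bosonization.comul a)) = a := by
  induction a with
  | zero => simp
  | add x y hx hy => simp only [map_add, hx, hy]
  | tmul r h =>
    rw [bosonization_comul_tmul]
    have key : ∀ (t : R ⊗[k] R) (p : H ⊗[k] H), TensorProduct.rid k (R ⊗[k] H)
        (𝓡.bosonization.counit.lTensor (R ⊗[k] H) (cosmash 𝓡.toActCoact (t ⊗ₜ p))) =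
        TensorProduct.rid k R ((Coalgebra.counit (R := k) (A := R)).lTensor R t) ⊗ₜ
          TensorProduct.rid k H ((Coalgebra.counit (R := k) (A := H)).lTensor H p) := by
      intro t p
      induction t with
      | zero => simp
      | add x y hx hy => simp only [TensorProduct.add_tmul, map_add, hx, hy]
      | tmul r₁ r₂ =>
      induction p with
      | zero => simp
      | add x y hx hy => simp only [TensorProduct.tmul_add, map_add, hx, hy]
      | tmul h₁ h₂ =>
        rw [cosmash_tmul]
        have : ∀ x : H ⊗[k] R, TensorProduct.rid k (R ⊗[k] H)
            (𝓡.bosonization.counit.lTensor (R ⊗[k] H)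
              (TensorProduct.map (TensorProduct.mk k R H r₁ ∘ₗ LinearMap.mulRight k h₁)
                ((TensorProduct.mk k R H).flip h₂) x)) =
            Coalgebra.counit (R := k) h₂ • (r₁ ⊗ₜ (TensorProduct.rid k H
              ((Coalgebra.counit (R := k) (A := R)).lTensor H x) * h₁)) := by
          intro x
          induction x with
          | zero => simp
          | add x y hx hy =>
            simp only [TensorProduct.tmul_add, map_add, hx, hy, smul_add, add_mul]
          | tmul c u =>
            simp only [TensorProduct.map_tmul, LinearMap.comp_apply, LinearMap.mulRight_apply,
              TensorProduct.mk_apply, LinearMap.lTensor_tmul, LinearMap.flip_apply,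
              TensorProduct.rid_tmul, bosonization_counit_tmul, smul_mul_assoc,
              TensorProduct.tmul_smul, smul_smul]
            congr 1
            ring
        rw [this, lTensor_counit_coact]
        simp [TensorProduct.smul_tmul']
    rw [key, Coalgebra.lTensor_counit_comul, Coalgebra.lTensor_counit_comul]
    simp

end Hopf

/-! ### Coassociativity and the antipode of the bosonization -/

section Hopf

variable {k H R : Type*} [Field k] [Ring H] [HopfAlgebra k H] [Ring R] [Algebra k R]
  [Coalgebra k R] (𝓡 : YDHopfAlgebra k H R)

/-- `r ⊗ y ↦ Δ(r₍₋₁₎) y ⊗ r₍₀₎` for `y ∈ H ⊗ H`. -/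
noncomputable def comulSwap : R ⊗[k] (H ⊗[k] H) →ₗ[k] (H ⊗[k] H) ⊗[k] R :=
  (LinearMap.mul' k (H ⊗[k] H)).rTensor R ∘ₗ
    (TensorProduct.rightComm k (H ⊗[k] H) R (H ⊗[k] H)).toLinearMap ∘ₗ
    ((Coalgebra.comul (R := k) (A := H)).rTensor R ∘ₗ 𝓡.coact).rTensor (H ⊗[k] H)

theorem comulSwap_tmul (r : R) (y : H ⊗[k] H) :
    comulSwap 𝓡 (r ⊗ₜ y) = (LinearMap.mulRight k y).rTensor R
      ((Coalgebra.comul (R := k) (A := H)).rTensor R (𝓡.coact r)) := by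
  simp only [comulSwap, LinearMap.comp_apply, LinearMap.rTensor_tmul, LinearEquiv.coe_coe]
  generalize (Coalgebra.comul (R := k) (A := H)).rTensor R (𝓡.coact r) = z
  induction z with
  | zero => simp
  | tmul a b => simp
  | add x y hx hy => simp only [TensorProduct.add_tmul, LinearMap.map_add, LinearEquiv.map_add, hx,
      hy]

/-- `(r ⊗ s) ⊗ h ↦ r₍₋₁₎ s₍₋₁₎ h ⊗ (r₍₀₎ ⊗ s₍₀₎)`. -/
noncomputable def tensorSwap : (R ⊗[k] R) ⊗[k] H →ₗ[k] H ⊗[k] (R ⊗[k] R) :=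
  cosmashSwap (HopfMaps.ofHopfAlgebra k H)
    (ActCoact.tensor (HopfMaps.ofHopfAlgebra k H) 𝓡.toActCoact 𝓡.toActCoact)

/-- `Δ ⊗ id` passes through `cosmash` since the comultiplication of `H` is multiplicative. -/
theorem rTensor_comul_cosmash (t : R ⊗[k] R) (p : H ⊗[k] H) :
    𝓡.bosonization.comul.rTensor (R ⊗[k] H) (cosmash 𝓡.toActCoact (t ⊗ₜ p)) =
    (cosmash 𝓡.toActCoact).rTensor (R ⊗[k] H) (interchange (comulSwap 𝓡)
      ((Coalgebra.comul (R := k) (A := R)).rTensor R t ⊗ₜ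
        (Coalgebra.comul (R := k) (A := H)).rTensor H p)) := by
  induction t with
  | zero => simp only [TensorProduct.zero_tmul, LinearMap.map_zero]
  | add x y hx hy => simp only [TensorProduct.add_tmul, LinearMap.map_add, hx, hy]
  | tmul r₁ r₂ =>
  induction p with
  | zero => simp only [TensorProduct.tmul_zero, LinearMap.map_zero]
  | add x y hx hy => simp only [TensorProduct.tmul_add, LinearMap.map_add, hx, hy]
  | tmul h₁ h₂ =>
    rw [cosmash_tmul, LinearMap.rTensor_tmul, LinearMap.rTensor_tmul, interchange_tmul,
      comulSwap_tmul]
    generalize 𝓡.coact r₂ = x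
    induction x with
    | zero => simp only [LinearMap.map_zero]
    | tmul c u =>
      simp only [TensorProduct.map_tmul, LinearMap.comp_apply, LinearMap.mulRight_apply,
        TensorProduct.mk_apply, LinearMap.flip_apply, LinearMap.rTensor_tmul,
        bosonization_comul_tmul, Bialgebra.comul_mul]
    | add x y hx hy => simp only [LinearMap.map_add, hx, hy]

/-- `id ⊗ Δ` passes through `cosmash` since the comultiplication of `R` is `H`-colinear. -/
theorem lTensor_comul_cosmash (t : R ⊗[k] R) (p : H ⊗[k] H) :
    𝓡.bosonization.comul.lTensor (R ⊗[k] H) (cosmash 𝓡.toActCoact (t ⊗ₜ p)) =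
    (cosmash 𝓡.toActCoact).lTensor (R ⊗[k] H) (interchange (tensorSwap 𝓡)
      ((Coalgebra.comul (R := k) (A := R)).lTensor R t ⊗ₜ
        (Coalgebra.comul (R := k) (A := H)).lTensor H p)) := by
  induction t with
  | zero => simp only [TensorProduct.zero_tmul, LinearMap.map_zero]
  | add x y hx hy => simp only [TensorProduct.add_tmul, LinearMap.map_add, hx, hy]
  | tmul r₁ r₂ =>
  induction p with
  | zero => simp only [TensorProduct.tmul_zero, LinearMap.map_zero]
  | add x y hx hy => simp only [TensorProduct.tmul_add, LinearMap.map_add, hx, hy]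
  | tmul h₁ h₂ =>
    rw [cosmash_tmul, LinearMap.lTensor_tmul, LinearMap.lTensor_tmul, interchange_tmul,
      tensorSwap, cosmashSwap_tmul, coact_comul]
    generalize 𝓡.coact r₂ = x
    induction x with
    | zero => simp only [LinearMap.map_zero]
    | tmul c u =>
      simp only [TensorProduct.map_tmul, LinearMap.comp_apply, LinearMap.mulRight_apply,
        TensorProduct.mk_apply, LinearMap.flip_apply, LinearMap.rTensor_tmul,
        LinearMap.lTensor_tmul, bosonization_comul_tmul]
    | add x y hx hy => simp only [LinearMap.map_add, hx, hy]

/-- `(b ⊗ v) ⊗ (c ⊗ (d ⊗ u)) ↦ (r # b c h₁) ⊗ ((v # d h₂) ⊗ (u # h₃))`. -/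
noncomputable def cosmashThree (r : R) (h₁ h₂ h₃ : H) :
    (H ⊗[k] R) ⊗[k] (H ⊗[k] (H ⊗[k] R)) →ₗ[k]
      (R ⊗[k] H) ⊗[k] ((R ⊗[k] H) ⊗[k] (R ⊗[k] H)) :=
  TensorProduct.map
      (TensorProduct.mk k R H r ∘ₗ LinearMap.mulRight k h₁ ∘ₗ LinearMap.mul' k H)
      (TensorProduct.map ((LinearMap.mulRight k h₂).lTensor R)
        ((TensorProduct.mk k R H).flip h₃) ∘ₗ
          (TensorProduct.assoc k R H R).symm.toLinearMap) ∘ₗ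
    (TensorProduct.tensorTensorTensorComm k H R H (H ⊗[k] R)).toLinearMap

omit [Coalgebra k R] in
theorem cosmashThree_tmul (r : R) (h₁ h₂ h₃ b c d : H) (v u : R) :
    cosmashThree (k := k) r h₁ h₂ h₃ ((b ⊗ₜ v) ⊗ₜ (c ⊗ₜ (d ⊗ₜ u))) =
      (r ⊗ₜ (b * c * h₁)) ⊗ₜ ((v ⊗ₜ (d * h₂)) ⊗ₜ (u ⊗ₜ h₃)) := rfl

theorem assoc_cosmash_comulSwap (r₁ r₂ : R) (h₁ h₂ h₃ : H) (z : (H ⊗[k] H) ⊗[k] R) :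
    TensorProduct.assoc k (R ⊗[k] H) (R ⊗[k] H) (R ⊗[k] H)
      ((cosmash 𝓡.toActCoact).rTensor (R ⊗[k] H)
        (TensorProduct.map (TensorProduct.mk k (R ⊗[k] R) (H ⊗[k] H) (r₁ ⊗ₜ r₂))
          ((TensorProduct.mk k R H).flip h₃)
          ((LinearMap.mulRight k (h₁ ⊗ₜ h₂)).rTensor R z))) =
    cosmashThree r₁ h₁ h₂ h₃ (𝓡.coact r₂ ⊗ₜ TensorProduct.assoc k H H R z) := by
  induction z with
  | zero => simp only [TensorProduct.tmul_zero, LinearMap.map_zero, LinearEquiv.map_zero]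
  | add x y hx hy => simp only [TensorProduct.tmul_add, LinearMap.map_add, LinearEquiv.map_add, hx,
      hy]
  | tmul z u =>
  induction z with
  | zero => simp only [TensorProduct.zero_tmul, TensorProduct.tmul_zero, LinearMap.map_zero,
      LinearEquiv.map_zero]
  | add x y hx hy => simp only [TensorProduct.tmul_add, TensorProduct.add_tmul, LinearMap.map_add,
      LinearEquiv.map_add, hx, hy]
  | tmul c d =>
    simp only [LinearMap.rTensor_tmul, LinearMap.mulRight_apply, TensorProduct.map_tmul,
      Algebra.TensorProduct.tmul_mul_tmul, TensorProduct.mk_apply, LinearMap.flip_apply,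
      cosmash_tmul, TensorProduct.assoc_tmul]
    generalize 𝓡.coact r₂ = x
    induction x with
    | zero => simp only [TensorProduct.zero_tmul, LinearMap.map_zero, LinearEquiv.map_zero]
    | add x y hx hy => simp only [TensorProduct.add_tmul, LinearMap.map_add, LinearEquiv.map_add,
        hx, hy]
    | tmul b v =>
      simp only [cosmashThree_tmul, TensorProduct.map_tmul, LinearMap.comp_apply,
        LinearMap.mulRight_apply, TensorProduct.mk_apply, LinearMap.flip_apply,
        TensorProduct.assoc_tmul, mul_assoc]

theorem cosmash_tensorSwap (r₁ : R) (h₁ h₂ h₃ : H) (x y : H ⊗[k] R) :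
    (cosmash 𝓡.toActCoact).lTensor (R ⊗[k] H)
      (TensorProduct.map (TensorProduct.mk k R H r₁)
        ((TensorProduct.mk k (R ⊗[k] R) (H ⊗[k] H)).flip (h₂ ⊗ₜ h₃))
        ((LinearMap.mulRight k h₁).rTensor (R ⊗[k] R)
          ((LinearMap.mul' k H).rTensor (R ⊗[k] R)
            (TensorProduct.tensorTensorTensorComm k H R H R (x ⊗ₜ y))))) =
    cosmashThree r₁ h₁ h₂ h₃ (x ⊗ₜ 𝓡.coact.lTensor H y) := by
  induction x with
  | zero => simp only [TensorProduct.zero_tmul, LinearMap.map_zero, LinearEquiv.map_zero]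
  | add x y hx hy => simp only [TensorProduct.add_tmul, LinearMap.map_add, LinearEquiv.map_add, hx,
      hy]
  | tmul b v =>
  induction y with
  | zero => simp only [TensorProduct.tmul_zero, LinearMap.map_zero, LinearEquiv.map_zero]
  | add x y hx hy => simp only [TensorProduct.tmul_add, LinearMap.map_add, LinearEquiv.map_add, hx,
      hy]
  | tmul c u =>
    simp only [TensorProduct.tensorTensorTensorComm_tmul, LinearMap.rTensor_tmul,
      LinearMap.mul'_apply, LinearMap.mulRight_apply, TensorProduct.map_tmul,
      TensorProduct.mk_apply, LinearMap.flip_apply, LinearMap.lTensor_tmul, cosmash_tmul]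
    generalize 𝓡.coact u = z
    induction z with
    | zero => simp only [TensorProduct.tmul_zero, LinearMap.map_zero]
    | add x y hx hy => simp only [TensorProduct.tmul_add, LinearMap.map_add, hx, hy]
    | tmul d u =>
      simp only [cosmashThree_tmul, TensorProduct.map_tmul, LinearMap.comp_apply,
        LinearMap.mulRight_apply, TensorProduct.mk_apply, LinearMap.flip_apply]

/-- Before the comultiplications of `R` and `H` enter, the two sides of coassociativity agree by the
comodule axiom for `R`. -/
theorem assoc_cosmash (t : (R ⊗[k] R) ⊗[k] R) (p : (H ⊗[k] H) ⊗[k] H) :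
    TensorProduct.assoc k (R ⊗[k] H) (R ⊗[k] H) (R ⊗[k] H)
      ((cosmash 𝓡.toActCoact).rTensor (R ⊗[k] H) (interchange (comulSwap 𝓡) (t ⊗ₜ p))) =
    (cosmash 𝓡.toActCoact).lTensor (R ⊗[k] H) (interchange (tensorSwap 𝓡)
      (TensorProduct.assoc k R R R t ⊗ₜ TensorProduct.assoc k H H H p)) := by
  induction t with
  | zero => simp only [TensorProduct.zero_tmul, LinearMap.map_zero, LinearEquiv.map_zero]
  | add x y hx hy => simp only [TensorProduct.add_tmul, LinearMap.map_add, LinearEquiv.map_add, hx,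
      hy]
  | tmul t r₃ =>
  induction t with
  | zero => simp only [TensorProduct.zero_tmul, LinearMap.map_zero, LinearEquiv.map_zero]
  | add x y hx hy => simp only [TensorProduct.add_tmul, LinearMap.map_add, LinearEquiv.map_add, hx,
      hy]
  | tmul r₁ r₂ =>
  induction p with
  | zero => simp only [TensorProduct.tmul_zero, LinearMap.map_zero, LinearEquiv.map_zero]
  | add x y hx hy => simp only [TensorProduct.tmul_add, LinearMap.map_add, LinearEquiv.map_add, hx,
      hy]
  | tmul p h₃ =>
  induction p with
  | zero => simp only [TensorProduct.zero_tmul, TensorProduct.tmul_zero, LinearMap.map_zero,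
      LinearEquiv.map_zero]
  | add x y hx hy => simp only [TensorProduct.tmul_add, TensorProduct.add_tmul, LinearMap.map_add,
      LinearEquiv.map_add, hx, hy]
  | tmul h₁ h₂ =>
    have hco : TensorProduct.assoc k H H R
        ((Coalgebra.comul (R := k) (A := H)).rTensor R (𝓡.coact r₃)) =
        𝓡.coact.lTensor H (𝓡.coact r₃) := 𝓡.isYD.coassoc r₃
    rw [TensorProduct.assoc_tmul, TensorProduct.assoc_tmul, interchange_tmul, interchange_tmul,
      comulSwap_tmul, tensorSwap, cosmashSwap_tmul, tensor_coact_tmul, assoc_cosmash_comulSwap,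
      cosmash_tensorSwap, hco]

/-- Both iterated coproducts of `r # h` equal
`(r¹ # (r²)₍₋₁₎ (r³)₍₋₂₎ h₁) ⊗ ((r²)₍₀₎ # (r³)₍₋₁₎ h₂) ⊗ ((r³)₍₀₎ # h₃)`. -/
theorem bosonization_coassoc (a : R ⊗[k] H) :
    TensorProduct.assoc k (R ⊗[k] H) (R ⊗[k] H) (R ⊗[k] H)
      (𝓡.bosonization.comul.rTensor (R ⊗[k] H) (𝓡.bosonization.comul a)) =
    𝓡.bosonization.comul.lTensor (R ⊗[k] H) (𝓡.bosonization.comul a) := by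
  induction a with
  | zero => simp only [LinearMap.map_zero, LinearEquiv.map_zero]
  | add x y hx hy => simp only [LinearMap.map_add, LinearEquiv.map_add, hx, hy]
  | tmul r h =>
    rw [bosonization_comul_tmul, rTensor_comul_cosmash, lTensor_comul_cosmash, assoc_cosmash,
      Coalgebra.coassoc_apply, Coalgebra.coassoc_apply]

theorem bosonization_antipode_mul (a : R ⊗[k] H) :
    𝓡.bosonization.mul (𝓡.bosonization.antipode.rTensor (R ⊗[k] H) (𝓡.bosonization.comul a)) =
      𝓡.bosonization.counit a • 𝓡.bosonization.one := by
  induction a with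
  | zero => simp
  | add x y hx hy => simp only [LinearMap.map_add, hx, hy, add_smul]
  | tmul r h =>
  rw [bosonization_comul_tmul]
  -- `E h₁ h₂ (c ⊗ v) = (1 # S(c h₁)) (v # h₂)`
  let E : H → H → H ⊗[k] R →ₗ[k] R ⊗[k] H := fun h₁ h₂ => 𝓡.bosonization.mul ∘ₗ
    TensorProduct.map (TensorProduct.mk k R H 1 ∘ₗ HopfAlgebra.antipode k ∘ₗ
      LinearMap.mulRight k h₁) ((TensorProduct.mk k R H).flip h₂)
  have hE : ∀ h₁ h₂ (t : R ⊗[k] R),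
      𝓡.bosonization.mul (𝓡.bosonization.antipode.rTensor (R ⊗[k] H)
        (cosmash 𝓡.toActCoact (t ⊗ₜ (h₁ ⊗ₜ h₂)))) =
      E h₁ h₂ ((LinearMap.mul' k R ∘ₗ 𝓡.antipode.rTensor R).lTensor H
        ((ActCoact.tensor (HopfMaps.ofHopfAlgebra k H) 𝓡.toActCoact 𝓡.toActCoact).coact t)) := by
    intro h₁ h₂ t
    induction t with
    | zero => simp
    | add x y hx hy => simp only [TensorProduct.add_tmul, LinearMap.map_add, hx, hy]
    | tmul r₁ r₂ =>
      rw [cosmash_tmul, tensor_coact_tmul]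
      generalize 𝓡.coact r₂ = y
      induction y with
      | zero => simp
      | add x y hx hy => simp only [TensorProduct.tmul_add, LinearMap.map_add, LinearEquiv.map_add,
          hx, hy]
      | tmul c u =>
        simp only [TensorProduct.map_tmul, LinearMap.comp_apply, LinearMap.mulRight_apply,
          TensorProduct.mk_apply, LinearMap.flip_apply, LinearMap.rTensor_tmul,
          bosonization_antipode_tmul]
        generalize 𝓡.coact r₁ = x
        induction x with
        | zero => simp
        | add x y hx hy => simp only [TensorProduct.add_tmul, LinearMap.map_add,
            LinearEquiv.map_add, hx, hy]
        | tmul b v =>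
          have hv : 𝓡.bosonization.mul ((𝓡.antipode v ⊗ₜ (1 : H)) ⊗ₜ (u ⊗ₜ h₂)) =
              (𝓡.antipode v * u) ⊗ₜ h₂ := by
            rw [bosonization_mul_tmul, Bialgebra.comul_one, Algebra.TensorProduct.one_def]
            simp [act_one_left]
          simp [E, bosonization_mul_assoc, hv, mul_assoc]
  have hS : ∀ p : H ⊗[k] H,
      𝓡.bosonization.mul (𝓡.bosonization.antipode.rTensor (R ⊗[k] H)
        (cosmash 𝓡.toActCoact (Coalgebra.comul r ⊗ₜ p))) =
      Coalgebra.counit (R := k) r • (1 : R) ⊗ₜ[k]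
        LinearMap.mul' k H ((HopfAlgebra.antipode k (A := H)).rTensor H p) := by
    intro p
    induction p with
    | zero => simp
    | add x y hx hy => simp only [TensorProduct.tmul_add, LinearMap.map_add, hx, hy, smul_add]
    | tmul h₁ h₂ =>
      have hmul : ∀ x : H, 𝓡.bosonization.mul (((1 : R) ⊗ₜ x) ⊗ₜ ((1 : R) ⊗ₜ h₂)) =
          (1 : R) ⊗ₜ (x * h₂) := by
        intro x
        rw [bosonization_mul_tmul]
        have : ∀ t : H ⊗[k] H, TensorProduct.map
            (LinearMap.mulLeft k 1 ∘ₗ 𝓡.act ∘ₗ (TensorProduct.mk k H R).flip 1)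
            (LinearMap.mulRight k h₂) t =
            (1 : R) ⊗ₜ (TensorProduct.lid k H
              ((Coalgebra.counit (R := k) (A := H)).rTensor H t) * h₂) := by
          intro t
          induction t with
          | zero => simp
          | add x y hx hy => simp only [TensorProduct.tmul_add, add_mul, LinearMap.map_add,
              LinearEquiv.map_add, hx, hy]
          | tmul a b => simp [act_one, TensorProduct.smul_tmul]
        rw [this, Coalgebra.rTensor_counit_comul]
        simp
      have hε : LinearMap.mul' k R ∘ₗ 𝓡.antipode.rTensor R ∘ₗ Coalgebra.comul =
          Algebra.linearMap k R ∘ₗ Coalgebra.counit :=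
        LinearMap.ext fun s => 𝓡.antipode_mul_id s
      rw [hE, coact_comul, ← LinearMap.lTensor_comp_apply, LinearMap.comp_assoc, hε,
        LinearMap.lTensor_comp_apply, lTensor_counit_coact]
      simp [E, hmul, Algebra.algebraMap_eq_smul_one]
  rw [hS, HopfAlgebra.mul_antipode_rTensor_comul_apply, bosonization_counit_tmul,
    bosonization_one, Algebra.algebraMap_eq_smul_one, TensorProduct.tmul_smul, smul_smul]

theorem bosonization_isLeftHopf : 𝓡.bosonization.IsLeftHopf where
  one_mul := bosonization_one_mul 𝓡
  mul_one := bosonization_mul_one 𝓡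
  mul_assoc := bosonization_mul_assoc 𝓡
  counit_comul := bosonization_counit_comul 𝓡
  comul_counit := bosonization_comul_counit 𝓡
  coassoc := bosonization_coassoc 𝓡
  antipode_mul := bosonization_antipode_mul 𝓡

end Hopf

/-! ### Gradings of the bosonization -/

section TensComponents

variable {k ι V U : Type*} [Field k] [DecidableEq ι] [AddCommGroup V] [Module k V]
  [AddCommGroup U] [Module k U] {𝒱 : ι → Submodule k V} [DirectSum.Decomposition 𝒱]

theorem lTensor_comp_of_mem_tens {i : ι} {x : U ⊗[k] V}
    (hx : x ∈ tens (⊤ : Submodule k U) (𝒱 i)) (j : ι) :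
    (comp 𝒱 j).lTensor U x = if j = i then x else 0 := by
  have : tens (⊤ : Submodule k U) (𝒱 i) ≤
      LinearMap.eqLocus ((comp 𝒱 j).lTensor U) (if j = i then LinearMap.id else 0) :=
    tens_le.2 fun a _ b hb => by
      rw [LinearMap.mem_eqLocus, LinearMap.lTensor_tmul]
      split_ifs with h
      · subst h
        rw [comp_of_mem hb]
        rfl
      · rw [comp_of_mem_ne h hb]
        simp
  rw [show (comp 𝒱 j).lTensor U x = _ from this hx]
  split_ifs <;> rfl

theorem IsYDSub.coact_comp {A : Type*} [AddCommGroup A] [Module k A] {M : ActCoact k A V}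
    (h : ∀ i, IsYDSub M (𝒱 i)) (j : ι) (v : V) :
    M.coact (comp 𝒱 j v) = (comp 𝒱 j).lTensor A (M.coact v) := by
  have : M.coact ∘ₗ comp 𝒱 j = (comp 𝒱 j).lTensor A ∘ₗ M.coact :=
    ext_homogeneous 𝒱 fun i v hv => by
      simp only [LinearMap.comp_apply]
      rw [lTensor_comp_of_mem_tens ((h i).coact_mem v hv)]
      split_ifs with hj
      · subst hj
        rw [comp_of_mem hv]
      · rw [comp_of_mem_ne hj hv, map_zero]
  exact LinearMap.congr_fun this v

end TensComponents

section Grading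

variable {k H R : Type*} [Field k] [Ring H] [HopfAlgebra k H] [Ring R] [Algebra k R]
  [Coalgebra k R] {𝓡 : YDHopfAlgebra k H R} {ℛ : ℕ → Submodule k R} [DirectSum.Decomposition ℛ]
  (hℛ : IsGradedYDHopfAlgebra 𝓡 ℛ)
include hℛ

theorem map_comp_comul (i j : ℕ) (r : R) :
    TensorProduct.map (comp ℛ i) (comp ℛ j) (Coalgebra.comul r) =
      TensorProduct.map (comp ℛ i) (comp ℛ j) (Coalgebra.comul (comp ℛ (i + j) r)) := by
  have : TensorProduct.map (comp ℛ i) (comp ℛ j) ∘ₗ Coalgebra.comul =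
      TensorProduct.map (comp ℛ i) (comp ℛ j) ∘ₗ Coalgebra.comul ∘ₗ comp ℛ (i + j) :=
    ext_homogeneous ℛ fun n r hr => by
      simp only [LinearMap.comp_apply]
      by_cases hn : i + j = n
      · subst hn
        rw [comp_of_mem hr]
      · rw [comp_of_mem_ne hn hr, map_zero, map_zero]
        have hle : (⨆ (i' : ℕ) (j' : ℕ) (_ : i' + j' = n), tens (ℛ i') (ℛ j')) ≤
            LinearMap.ker (TensorProduct.map (comp ℛ i) (comp ℛ j)) := by
          refine iSup_le fun i' => iSup_le fun j' => iSup_le fun hij =>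
            tens_le.2 fun a ha b hb => ?_
          rw [LinearMap.mem_ker, TensorProduct.map_tmul]
          by_cases hi : i = i'
          · have hj : j ≠ j' := by omega
            rw [comp_of_mem_ne hj hb, TensorProduct.tmul_zero]
          · rw [comp_of_mem_ne hi ha, TensorProduct.zero_tmul]
        exact hle (hℛ.comul_mem n r hr)
  exact LinearMap.congr_fun this r

theorem comul_eq_map_comp_zero {r : R} (hr : r ∈ ℛ 0) :
    TensorProduct.map (comp ℛ 0) (comp ℛ 0) (Coalgebra.comul r) = Coalgebra.comul r := by
  have hle : (⨆ (i' : ℕ) (j' : ℕ) (_ : i' + j' = 0), tens (ℛ i') (ℛ j')) ≤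
      LinearMap.eqLocus (TensorProduct.map (comp ℛ 0) (comp ℛ 0)) LinearMap.id := by
    refine iSup_le fun i' => iSup_le fun j' => iSup_le fun hij => tens_le.2 fun a ha b hb => ?_
    obtain rfl : i' = 0 := by omega
    obtain rfl : j' = 0 := by omega
    rw [LinearMap.mem_eqLocus, TensorProduct.map_tmul, comp_of_mem ha, comp_of_mem hb,
      LinearMap.id_apply]
  exact hle (hℛ.comul_mem 0 r hr)

theorem bosonization_mul_graded (i j : ℕ) (a b : R ⊗[k] H) :
    (comp ℛ (i + j)).rTensor H
      (𝓡.bosonization.mul ((comp ℛ i).rTensor H a ⊗ₜ (comp ℛ j).rTensor H b)) =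
      𝓡.bosonization.mul ((comp ℛ i).rTensor H a ⊗ₜ (comp ℛ j).rTensor H b) := by
  induction a with
  | zero => simp only [TensorProduct.zero_tmul, map_zero]
  | add x y hx hy => simp only [TensorProduct.add_tmul, map_add, hx, hy]
  | tmul r h =>
  induction b with
  | zero => simp only [TensorProduct.tmul_zero, map_zero]
  | add x y hx hy => simp only [TensorProduct.tmul_add, map_add, hx, hy]
  | tmul s g =>
    rw [LinearMap.rTensor_tmul, LinearMap.rTensor_tmul, bosonization_mul_tmul]
    generalize Coalgebra.comul (R := k) h = t
    induction t with
    | zero => simp only [map_zero]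
    | add x y hx hy => simp only [map_add, hx, hy]
    | tmul x y =>
      simp only [TensorProduct.map_tmul, LinearMap.rTensor_tmul, LinearMap.comp_apply,
        LinearMap.flip_apply, TensorProduct.mk_apply, LinearMap.mulLeft_apply]
      rw [comp_of_mem (hℛ.mul_mem i j _ (comp_mem ℛ i r) _
        ((hℛ.isYDSub j).act_mem x _ (comp_mem ℛ j s)))]

theorem bosonization_comul_graded (i j : ℕ) (a : R ⊗[k] H) :
    TensorProduct.map ((comp ℛ i).rTensor H) ((comp ℛ j).rTensor H) (𝓡.bosonization.comul a) =
      TensorProduct.map ((comp ℛ i).rTensor H) ((comp ℛ j).rTensor H)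
        (𝓡.bosonization.comul ((comp ℛ (i + j)).rTensor H a)) := by
  induction a with
  | zero => simp only [map_zero]
  | add x y hx hy => simp only [map_add, hx, hy]
  | tmul r h =>
    rw [LinearMap.rTensor_tmul, bosonization_comul_tmul, bosonization_comul_tmul,
      map_cosmash _ _ (IsYDSub.coact_comp hℛ.isYDSub j),
      map_cosmash _ _ (IsYDSub.coact_comp hℛ.isYDSub j), map_comp_comul hℛ]

theorem bosonization_counit_comp_zero (a : R ⊗[k] H) :
    𝓡.bosonization.counit ((comp ℛ 0).rTensor H a) = 𝓡.bosonization.counit a := by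
  have : (Coalgebra.counit (R := k) (A := R)) ∘ₗ comp ℛ 0 = Coalgebra.counit :=
    ext_homogeneous ℛ fun n r hr => by
      simp only [LinearMap.comp_apply]
      by_cases hn : 0 = n
      · subst hn
        rw [comp_of_mem hr]
      · rw [comp_of_mem_ne hn hr, map_zero, hℛ.counit_eq_zero n (Ne.symm hn) r hr]
  induction a with
  | zero => simp only [map_zero]
  | add x y hx hy => simp only [map_add, hx, hy]
  | tmul r h =>
    rw [LinearMap.rTensor_tmul, bosonization_counit_tmul, bosonization_counit_tmul,
      ← LinearMap.comp_apply, this]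

theorem isBraidedHom_subtype :
    IsBraidedHom (zeroHopfMaps 𝓡 ℛ) (zeroActCoact 𝓡 ℛ) 𝓡.hopfMaps 𝓡.toActCoact
      (ℛ 0).subtype where
  map_act h r := comp_of_mem ((hℛ.isYDSub 0).act_mem h r r.2)
  map_coact r := by
    have := lTensor_comp_of_mem_tens ((hℛ.isYDSub 0).coact_mem r r.2) 0
    rw [if_pos rfl, comp, LinearMap.lTensor_comp_apply] at this
    exact this.symm
  map_mul r s := comp_of_mem (hℛ.mul_mem 0 0 r r.2 s s.2)
  map_one := comp_of_mem hℛ.one_mem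
  map_comul r := by
    have := comul_eq_map_comp_zero hℛ r.2
    rw [comp, TensorProduct.map_comp, LinearMap.comp_apply] at this
    exact this
  map_counit _ := rfl
  map_antipode r := comp_of_mem (hℛ.antipode_mem 0 r r.2)

end Grading

/-! ### The degree zero part of the bosonization -/

section DegreeZero

variable {k H R : Type*} [Field k] [Ring H] [HopfAlgebra k H] [Ring R] [Algebra k R]
  {ℛ : ℕ → Submodule k R} [DirectSum.Decomposition ℛ]

variable (ℛ) (H) in
/-- The inclusion of `R(0) # H` into `R # H`. -/
noncomputable def incl : ℛ 0 ⊗[k] H →ₗ[k] R ⊗[k] H := (ℛ 0).subtype.rTensor H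

variable (ℛ) (H) in
/-- The projection of `R # H` onto `R(0) # H`. -/
noncomputable def retr : R ⊗[k] H →ₗ[k] ℛ 0 ⊗[k] H := (proj ℛ 0).rTensor H

theorem incl_retr (a : R ⊗[k] H) : incl H ℛ (retr H ℛ a) = (comp ℛ 0).rTensor H a :=
  (LinearMap.rTensor_comp_apply _ _ _ _).symm

theorem retr_comp_incl : retr H ℛ ∘ₗ incl H ℛ = LinearMap.id := by
  rw [retr, incl, ← LinearMap.rTensor_comp]
  have : proj ℛ 0 ∘ₗ (ℛ 0).subtype = LinearMap.id := LinearMap.ext fun r => proj_coe r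
  rw [this, LinearMap.rTensor_id]

theorem retr_incl (a : ℛ 0 ⊗[k] H) : retr H ℛ (incl H ℛ a) = a :=
  LinearMap.congr_fun retr_comp_incl a

theorem comp_incl (a : ℛ 0 ⊗[k] H) : (comp ℛ 0).rTensor H (incl H ℛ a) = incl H ℛ a := by
  rw [← incl_retr, retr_incl]

theorem retr_comp (a : R ⊗[k] H) : retr H ℛ ((comp ℛ 0).rTensor H a) = retr H ℛ a := by
  rw [← incl_retr, retr_incl]

theorem incl_injective : Function.Injective (incl H ℛ) :=
  Function.LeftInverse.injective retr_incl

end DegreeZero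

section Grading

variable {k H R : Type*} [Field k] [Ring H] [HopfAlgebra k H] [Ring R] [Algebra k R]
  [Coalgebra k R] {𝓡 : YDHopfAlgebra k H R} {ℛ : ℕ → Submodule k R} [DirectSum.Decomposition ℛ]
  (hℛ : IsGradedYDHopfAlgebra 𝓡 ℛ)
include hℛ

theorem incl_mul (a b : ℛ 0 ⊗[k] H) : incl H ℛ ((zeroBosonization 𝓡 ℛ).mul (a ⊗ₜ b)) =
    𝓡.bosonization.mul (incl H ℛ a ⊗ₜ incl H ℛ b) :=
  (isBraidedHom_subtype hℛ).bosonization_mul a b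

theorem incl_one : incl H ℛ (zeroBosonization 𝓡 ℛ).one = 𝓡.bosonization.one :=
  congrArg (fun r => r ⊗ₜ[k] (1 : H)) (isBraidedHom_subtype hℛ).map_one

theorem incl_comul (a : ℛ 0 ⊗[k] H) :
    TensorProduct.map (incl H ℛ) (incl H ℛ) ((zeroBosonization 𝓡 ℛ).comul a) =
      𝓡.bosonization.comul (incl H ℛ a) :=
  (isBraidedHom_subtype hℛ).bosonization_comul a

theorem incl_counit (a : ℛ 0 ⊗[k] H) :
    𝓡.bosonization.counit (incl H ℛ a) = (zeroBosonization 𝓡 ℛ).counit a :=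
  (isBraidedHom_subtype hℛ).bosonization_counit a

theorem incl_antipode (a : ℛ 0 ⊗[k] H) : incl H ℛ ((zeroBosonization 𝓡 ℛ).antipode a) =
    𝓡.bosonization.antipode (incl H ℛ a) :=
  (isBraidedHom_subtype hℛ).bosonization_antipode a

theorem retr_counit (a : R ⊗[k] H) :
    (zeroBosonization 𝓡 ℛ).counit (retr H ℛ a) = 𝓡.bosonization.counit a := by
  rw [← incl_counit hℛ, incl_retr, bosonization_counit_comp_zero hℛ]

theorem retr_comul (a : R ⊗[k] H) :
    TensorProduct.map (retr H ℛ) (retr H ℛ) (𝓡.bosonization.comul a) =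
      (zeroBosonization 𝓡 ℛ).comul (retr H ℛ a) := by
  have h1 : retr H ℛ = retr H ℛ ∘ₗ (comp ℛ 0).rTensor H :=
    LinearMap.ext fun a => (retr_comp a).symm
  have h2 : ∀ x, TensorProduct.map (retr H ℛ) (retr H ℛ) (TensorProduct.map
      ((comp ℛ 0).rTensor H) ((comp ℛ 0).rTensor H) x) =
      TensorProduct.map (retr H ℛ) (retr H ℛ) x := fun x => by
    rw [← LinearMap.comp_apply, ← TensorProduct.map_comp, ← h1]
  rw [← h2, bosonization_comul_graded hℛ 0 0, h2, zero_add, ← incl_retr, ← incl_comul hℛ,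
    ← LinearMap.comp_apply, ← TensorProduct.map_comp, retr_comp_incl, TensorProduct.map_id,
    LinearMap.id_apply]

theorem retr_mul_incl (a : R ⊗[k] H) (b : ℛ 0 ⊗[k] H) :
    retr H ℛ (𝓡.bosonization.mul (a ⊗ₜ incl H ℛ b)) =
      (zeroBosonization 𝓡 ℛ).mul (retr H ℛ a ⊗ₜ b) := by
  apply incl_injective
  rw [incl_mul hℛ, incl_retr, incl_retr]
  revert a
  refine fun a => LinearMap.congr_fun (f := (comp ℛ 0).rTensor H ∘ₗ 𝓡.bosonization.mul ∘ₗ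
    (TensorProduct.mk k _ _).flip (incl H ℛ b)) (g := 𝓡.bosonization.mul ∘ₗ
    (TensorProduct.mk k _ _).flip (incl H ℛ b) ∘ₗ (comp ℛ 0).rTensor H)
    ((isComponentFamily_comp ℛ).rTensor.ext_components fun n a => ?_) a
  simp only [LinearMap.comp_apply, LinearMap.flip_apply, TensorProduct.mk_apply]
  rw [← comp_incl b, ← bosonization_mul_graded hℛ, (isComponentFamily_comp ℛ).rTensor.orth,
    (isComponentFamily_comp ℛ).rTensor.orth]
  by_cases hn : 0 = n
  · subst hn
    simp only [if_true, add_zero, bosonization_mul_graded hℛ 0 0]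
  · simp [hn]

theorem retr_incl_mul (a : ℛ 0 ⊗[k] H) (b : R ⊗[k] H) :
    retr H ℛ (𝓡.bosonization.mul (incl H ℛ a ⊗ₜ b)) =
      (zeroBosonization 𝓡 ℛ).mul (a ⊗ₜ retr H ℛ b) := by
  apply incl_injective
  rw [incl_mul hℛ, incl_retr, incl_retr]
  revert b
  refine fun b => LinearMap.congr_fun (f := (comp ℛ 0).rTensor H ∘ₗ 𝓡.bosonization.mul ∘ₗ
    TensorProduct.mk k _ _ (incl H ℛ a)) (g := 𝓡.bosonization.mul ∘ₗ
    TensorProduct.mk k _ _ (incl H ℛ a) ∘ₗ (comp ℛ 0).rTensor H)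
    ((isComponentFamily_comp ℛ).rTensor.ext_components fun n b => ?_) b
  simp only [LinearMap.comp_apply, TensorProduct.mk_apply]
  rw [← comp_incl a, ← bosonization_mul_graded hℛ, (isComponentFamily_comp ℛ).rTensor.orth,
    (isComponentFamily_comp ℛ).rTensor.orth]
  by_cases hn : 0 = n
  · subst hn
    simp only [if_true, add_zero, bosonization_mul_graded hℛ 0 0]
  · simp [hn]

end Grading

section Modules

variable {k H R W : Type*} [Field k] [Ring H] [HopfAlgebra k H] [Ring R] [Algebra k R]
  [Coalgebra k R] {𝓡 : YDHopfAlgebra k H R} {ℛ : ℕ → Submodule k R} [DirectSum.Decomposition ℛ]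
  [AddCommGroup W] [Module k W] {M : ActCoact k (R ⊗[k] H) W} {𝒲 : ℤ → Submodule k W}
  [DirectSum.Decomposition 𝒲]

omit [Coalgebra k R] in
theorem rTensor_comp_mem_tens (n : ℕ) (a : R ⊗[k] H) :
    (comp ℛ n).rTensor H a ∈ tens (ℛ n) (⊤ : Submodule k H) := by
  induction a with
  | zero => rw [map_zero]; exact Submodule.zero_mem _
  | add x y hx hy => rw [map_add]; exact Submodule.add_mem _ hx hy
  | tmul r h => exact tmul_mem_tens (comp_mem ℛ n r) trivial

omit [Coalgebra k R] in
theorem rTensor_comp_of_mem_tens {n i : ℕ} {a : R ⊗[k] H}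
    (ha : a ∈ tens (ℛ n) (⊤ : Submodule k H)) :
    (comp ℛ i).rTensor H a = if i = n then a else 0 := by
  have : tens (ℛ n) (⊤ : Submodule k H) ≤
      LinearMap.eqLocus ((comp ℛ i).rTensor H) (if i = n then LinearMap.id else 0) :=
    tens_le.2 fun r hr h _ => by
      rw [LinearMap.mem_eqLocus, LinearMap.rTensor_tmul]
      split_ifs with hn
      · subst hn
        rw [comp_of_mem hr]
        rfl
      · rw [comp_of_mem_ne hn hr]
        simp
  rw [show (comp ℛ i).rTensor H a = _ from this ha]
  split_ifs <;> rfl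

theorem IsGradedYD.isGradedYDFamily (hℛ : IsGradedYDHopfAlgebra 𝓡 ℛ)
    (h : IsGradedYD 𝓡 ℛ M 𝒲) :
    IsGradedYDFamily 𝓡.bosonization M (fun n => (comp ℛ n).rTensor H) (comp 𝒲) where
  isYD := h.isYD
  left := (isComponentFamily_comp ℛ).rTensor
  right := isComponentFamily_comp 𝒲
  mul := bosonization_mul_graded hℛ
  comul := bosonization_comul_graded hℛ
  act n m a w := by
    have : comp 𝒲 (n + m) ∘ₗ M.act ∘ₗ TensorProduct.mk k _ W ((comp ℛ n).rTensor H a) =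
        M.act ∘ₗ TensorProduct.mk k _ W ((comp ℛ n).rTensor H a) ∘ₗ comp 𝒲 m :=
      ext_homogeneous 𝒲 fun i w hw => by
        simp only [LinearMap.comp_apply, TensorProduct.mk_apply]
        have hmem := h.act_mem n i _ (rTensor_comp_mem_tens n a) w hw
        by_cases hi : m = i
        · subst hi
          rw [comp_of_mem hw, comp_of_mem hmem]
        · rw [comp_of_mem_ne hi hw, comp_of_mem_ne (by omega) hmem, TensorProduct.tmul_zero,
            map_zero]
    exact LinearMap.congr_fun this w
  coact n m w := by
    have : TensorProduct.map ((comp ℛ n).rTensor H) (comp 𝒲 m) ∘ₗ M.coact =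
        ((comp ℛ n).rTensor H).rTensor W ∘ₗ M.coact ∘ₗ comp 𝒲 (n + m) :=
      ext_homogeneous 𝒲 fun i w hw => by
        have hle : (⨆ j : ℕ, tens (tens (ℛ j) (⊤ : Submodule k H)) (𝒲 (i - j))) ≤
            LinearMap.eqLocus (TensorProduct.map ((comp ℛ n).rTensor H) (comp 𝒲 m))
              (if n + m = i then ((comp ℛ n).rTensor H).rTensor W else 0) := by
          refine iSup_le fun j => tens_le.2 fun a ha v hv => ?_
          rw [LinearMap.mem_eqLocus, TensorProduct.map_tmul, rTensor_comp_of_mem_tens ha]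
          by_cases hj : n = j
          · subst hj
            by_cases hi : n + m = i
            · have hm : m = i - n := by omega
              rw [if_pos rfl, if_pos hi, LinearMap.rTensor_tmul, rTensor_comp_of_mem_tens ha,
                if_pos rfl, hm, comp_of_mem hv]
            · have hm : m ≠ i - n := by omega
              rw [if_neg hi, comp_of_mem_ne hm hv, TensorProduct.tmul_zero, LinearMap.zero_apply]
          · rw [if_neg hj, TensorProduct.zero_tmul]
            split_ifs
            · rw [LinearMap.rTensor_tmul, rTensor_comp_of_mem_tens ha, if_neg hj,
                TensorProduct.zero_tmul]
            · rfl
        have hx := hle (h.coact_mem i w hw)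
        rw [LinearMap.mem_eqLocus] at hx
        rw [LinearMap.comp_apply, hx, LinearMap.comp_apply, LinearMap.comp_apply]
        split_ifs with hi
        · rw [hi, comp_of_mem hw]
        · rw [comp_of_mem_ne hi hw, map_zero, map_zero, LinearMap.zero_apply]
    exact LinearMap.congr_fun this w

/-! ### The homogeneous components as Yetter-Drinfeld modules -/

omit [Coalgebra k R] in
theorem component_act (m : ℤ) (a : ℛ 0 ⊗[k] H) (v : 𝒲 m) :
    (component ℛ M 𝒲 m).act (a ⊗ₜ v) = proj 𝒲 m (M.act (incl H ℛ a ⊗ₜ v)) := rfl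

omit [Coalgebra k R] in
theorem component_coact (m : ℤ) (v : 𝒲 m) : (component ℛ M 𝒲 m).coact v =
    TensorProduct.map (retr H ℛ) (proj 𝒲 m) (M.coact v) := rfl

section

variable (hℛ : IsGradedYDHopfAlgebra 𝓡 ℛ) (h : IsGradedYD 𝓡 ℛ M 𝒲)
include hℛ h

theorem proj_act_incl (m : ℤ) (a : ℛ 0 ⊗[k] H) (w : W) :
    proj 𝒲 m (M.act (incl H ℛ a ⊗ₜ w)) = (component ℛ M 𝒲 m).act (a ⊗ₜ proj 𝒲 m w) := by
  apply Subtype.ext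
  have h1 := (h.isGradedYDFamily hℛ).act 0 m (incl H ℛ a)
  simp only [comp_incl, Nat.cast_zero, zero_add] at h1
  rw [component_act, coe_proj, coe_proj, coe_proj, h1, h1,
    (isComponentFamily_comp 𝒲).idem]

theorem coe_component_act (m : ℤ) (a : ℛ 0 ⊗[k] H) (v : 𝒲 m) :
    ((component ℛ M 𝒲 m).act (a ⊗ₜ v) : W) = M.act (incl H ℛ a ⊗ₜ v) := by
  have h1 := (h.isGradedYDFamily hℛ).act 0 m (incl H ℛ a) v
  simp only [comp_incl, Nat.cast_zero, zero_add] at h1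
  rw [component_act, coe_proj, h1, comp_of_mem v.2]

theorem lTensor_component_coact (m : ℤ) (v : 𝒲 m) :
    (𝒲 m).subtype.lTensor _ ((component ℛ M 𝒲 m).coact v) =
      (retr H ℛ).rTensor W (M.coact v) := by
  have h1 := (h.isGradedYDFamily hℛ).coact 0 m v
  simp only [Nat.cast_zero, zero_add, comp_of_mem v.2] at h1
  have h2 : ∀ x : (R ⊗[k] H) ⊗[k] W, (retr H ℛ).rTensor W (((comp ℛ 0).rTensor H).rTensor W x) =
      (retr H ℛ).rTensor W x := fun x => by
    rw [← LinearMap.rTensor_comp_apply]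
    congr 2
    exact LinearMap.ext retr_comp
  have h3 : ∀ x : (R ⊗[k] H) ⊗[k] W, (𝒲 m).subtype.lTensor (ℛ 0 ⊗[k] H)
      (TensorProduct.map (retr H ℛ) (proj 𝒲 m) x) = (retr H ℛ).rTensor W
      (TensorProduct.map ((comp ℛ 0).rTensor H) (comp 𝒲 m) x) := fun x => by
    induction x with
    | zero => simp only [map_zero]
    | add x y hx hy => simp only [map_add, hx, hy]
    | tmul a w => simp [retr_comp, coe_proj]
  rw [component_coact, h3, h1, h2]

/-- Every component `W(m)` is a Yetter-Drinfeld module over `R(0) # H`, because the inclusion of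
`R(0) # H` is a Hopf algebra map and the projection onto it is a coalgebra map which commutes with
the multiplication by elements of `R(0) # H`. -/
theorem isYD_component (m : ℤ) : IsYD (zeroBosonization 𝓡 ℛ) (component ℛ M 𝒲 m) where
  one_act v := Subtype.ext <| by
    rw [coe_component_act hℛ h, incl_one hℛ, h.isYD.one_act]
  mul_act a b v := Subtype.ext <| by
    rw [coe_component_act hℛ h, incl_mul hℛ, h.isYD.mul_act, coe_component_act hℛ h,
      coe_component_act hℛ h]
  counit_coact v := by
    have key : ∀ x : (R ⊗[k] H) ⊗[k] W, TensorProduct.lid k (𝒲 m)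
        ((zeroBosonization 𝓡 ℛ).counit.rTensor (𝒲 m)
          (TensorProduct.map (retr H ℛ) (proj 𝒲 m) x)) =
        proj 𝒲 m (TensorProduct.lid k W (𝓡.bosonization.counit.rTensor W x)) := fun x => by
      induction x with
      | zero => simp only [map_zero]
      | add x y hx hy => simp only [map_add, hx, hy]
      | tmul a w => simp [retr_counit hℛ]
    rw [component_coact, key, h.isYD.counit_coact, proj_coe]
  coassoc v := by
    have hL : ∀ x : (R ⊗[k] H) ⊗[k] W, TensorProduct.assoc k _ _ (𝒲 m)
        ((zeroBosonization 𝓡 ℛ).comul.rTensor (𝒲 m)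
          (TensorProduct.map (retr H ℛ) (proj 𝒲 m) x)) =
        TensorProduct.map (retr H ℛ) (TensorProduct.map (retr H ℛ) (proj 𝒲 m))
          (TensorProduct.assoc k _ _ W (𝓡.bosonization.comul.rTensor W x)) := fun x => by
      induction x with
      | zero => simp only [map_zero]
      | add x y hx hy => simp only [map_add, hx, hy]
      | tmul a w =>
        rw [TensorProduct.map_tmul, LinearMap.rTensor_tmul, LinearMap.rTensor_tmul,
          ← retr_comul hℛ]
        generalize 𝓡.bosonization.comul a = t
        induction t with
        | zero => simp only [map_zero, TensorProduct.zero_tmul]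
        | add x y hx hy => simp only [map_add, TensorProduct.add_tmul, hx, hy]
        | tmul a b => simp only [TensorProduct.map_tmul, TensorProduct.assoc_tmul]
    have hR : ∀ x : (R ⊗[k] H) ⊗[k] W,
        (TensorProduct.map (retr H ℛ) (proj 𝒲 m) ∘ₗ M.coact).lTensor (ℛ 0 ⊗[k] H)
          ((retr H ℛ).rTensor W x) =
        TensorProduct.map (retr H ℛ) (TensorProduct.map (retr H ℛ) (proj 𝒲 m))
          (M.coact.lTensor (R ⊗[k] H) x) := fun x => by
      induction x with
      | zero => simp only [map_zero]
      | add x y hx hy => simp only [map_add, hx, hy]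
      | tmul a w => simp
    have hc : (component ℛ M 𝒲 m).coact =
        (TensorProduct.map (retr H ℛ) (proj 𝒲 m) ∘ₗ M.coact) ∘ₗ (𝒲 m).subtype := rfl
    rw [component_coact, hL, h.isYD.coassoc, ← hR, ← lTensor_component_coact hℛ h,
      ← LinearMap.lTensor_comp_apply, ← hc, component_coact]
  coact_act a v := by
    have key : ∀ (t : (ℛ 0 ⊗[k] H) ⊗[k] ((ℛ 0 ⊗[k] H) ⊗[k] (ℛ 0 ⊗[k] H)))
        (x : (R ⊗[k] H) ⊗[k] W),
        TensorProduct.map (retr H ℛ) (proj 𝒲 m) (ydTwist 𝓡.bosonization M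
          (TensorProduct.map (incl H ℛ) (TensorProduct.map (incl H ℛ) (incl H ℛ)) t ⊗ₜ x)) =
        ydTwist (zeroBosonization 𝓡 ℛ) (component ℛ M 𝒲 m)
          (t ⊗ₜ TensorProduct.map (retr H ℛ) (proj 𝒲 m) x) := by
      intro t x
      induction t with
      | zero => simp only [map_zero, TensorProduct.zero_tmul]
      | add x y hx hy => simp only [map_add, TensorProduct.add_tmul, hx, hy]
      | tmul a₁ s =>
      induction s with
      | zero => simp only [map_zero, TensorProduct.zero_tmul, TensorProduct.tmul_zero]
      | add x y hx hy =>
        simp only [map_add, TensorProduct.add_tmul, TensorProduct.tmul_add, hx, hy]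
      | tmul a₂ a₃ =>
      induction x with
      | zero => simp only [map_zero, TensorProduct.tmul_zero]
      | add x y hx hy => simp only [map_add, TensorProduct.tmul_add, hx, hy]
      | tmul c w =>
        simp only [TensorProduct.map_tmul, ydTwist_tmul]
        rw [← incl_antipode hℛ, retr_mul_incl hℛ, retr_incl_mul hℛ, proj_act_incl hℛ h]
    have hΔ : 𝓡.bosonization.comul.lTensor (R ⊗[k] H) (𝓡.bosonization.comul (incl H ℛ a)) =
        TensorProduct.map (incl H ℛ) (TensorProduct.map (incl H ℛ) (incl H ℛ))
          ((zeroBosonization 𝓡 ℛ).comul.lTensor (ℛ 0 ⊗[k] H)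
            ((zeroBosonization 𝓡 ℛ).comul a)) := by
      rw [← incl_comul hℛ]
      generalize (zeroBosonization 𝓡 ℛ).comul a = t
      induction t with
      | zero => simp only [map_zero]
      | add x y hx hy => simp only [map_add, hx, hy]
      | tmul b c =>
        simp only [TensorProduct.map_tmul, LinearMap.lTensor_tmul, ← incl_comul hℛ]
    rw [component_coact, coe_component_act hℛ h, h.isYD.coact_act, hΔ, key, component_coact]

/-- A Yetter-Drinfeld submodule of `W(m)` is stable under the action of `A(0)` on `W`. -/
theorem act_mem_map_subtype {m : ℤ} {N : Submodule k (𝒲 m)}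
    (hN : IsYDSub (component ℛ M 𝒲 m) N) (a : R ⊗[k] H) :
    ∀ v ∈ N.map (𝒲 m).subtype, M.act ((comp ℛ 0).rTensor H a ⊗ₜ v) ∈ N.map (𝒲 m).subtype := by
  rintro _ ⟨v, hv, rfl⟩
  refine ⟨_, hN.act_mem (retr H ℛ a) v hv, ?_⟩
  rw [Submodule.subtype_apply, coe_component_act hℛ h, incl_retr]
  rfl

/-- A Yetter-Drinfeld submodule of `W(m)` is stable under the part of the coaction of `W` with
values in `A(0) ⊗ W`. -/
theorem slice_mem_map_subtype {m : ℤ} {N : Submodule k (𝒲 m)}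
    (hN : IsYDSub (component ℛ M 𝒲 m) N) (f : R ⊗[k] H →ₗ[k] k) :
    ∀ v ∈ N.map (𝒲 m).subtype,
      slice (f ∘ₗ (comp ℛ 0).rTensor H) (M.coact v) ∈ N.map (𝒲 m).subtype := by
  rintro _ ⟨v, hv, rfl⟩
  refine ⟨_, mem_tens_top_iff.1 (hN.coact_mem v hv) (f ∘ₗ incl H ℛ), ?_⟩
  have : (comp ℛ 0).rTensor H = incl H ℛ ∘ₗ retr H ℛ :=
    LinearMap.ext fun a => (incl_retr a).symm
  rw [← slice_lTensor, lTensor_component_coact hℛ h, slice_rTensor, this, LinearMap.comp_assoc]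
  rfl

end

/-! ### The filtrations of a graded Yetter-Drinfeld module -/

/-- `r # h = (1 # h₂) (S⁻¹(h₁) • r # 1)`, so what is killed by `R(j)` is killed by `R(j) # H`. -/
theorem act_eq_zero_of_left (hS : Function.Bijective (HopfAlgebra.antipode k : H →ₗ[k] H))
    (hℛ : IsGradedYDHopfAlgebra 𝓡 ℛ) (h : IsYD 𝓡.bosonization M) {j : ℕ} {w : W}
    (hw : ∀ r ∈ ℛ j, M.act ((r ⊗ₜ 1) ⊗ₜ w) = 0) (a : R ⊗[k] H) :
    M.act ((comp ℛ j).rTensor H a ⊗ₜ w) = 0 := by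
  let S : H ≃ₗ[k] H := LinearEquiv.ofBijective _ hS
  have hSσ : ∀ x, HopfAlgebra.antipode k (S.symm x) = x := S.apply_symm_apply
  -- `h₂ S⁻¹(h₁) = ε(h)`
  have hσ : ∀ x : H, LinearMap.mul' k H (TensorProduct.comm k H H
      (S.symm.toLinearMap.rTensor H (Coalgebra.comul x))) =
      algebraMap k H (Coalgebra.counit x) := by
    intro x
    apply hS.1
    rw [Algebra.algebraMap_eq_smul_one, map_smul, HopfAlgebra.antipode_one,
      ← Algebra.algebraMap_eq_smul_one, ← HopfAlgebra.mul_antipode_lTensor_comul_apply]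
    generalize Coalgebra.comul (R := k) x = t
    induction t with
    | zero => simp only [map_zero]
    | add x y hx hy => simp only [map_add, hx, hy]
    | tmul x y => simp [HopfAlgebra.antipode_mul_antidistrib, hSσ]
  induction a with
  | zero => simp only [map_zero, TensorProduct.zero_tmul]
  | add x y hx hy => rw [map_add, TensorProduct.add_tmul, map_add, hx, hy, add_zero]
  | tmul r g =>
    rw [LinearMap.rTensor_tmul]
    have hr := comp_mem ℛ j r
    generalize comp ℛ j r = s at hr
    -- `G (x ⊗ y) = (1 # y) (S⁻¹(x) • s # 1)`
    let G : H ⊗[k] H →ₗ[k] R ⊗[k] H := 𝓡.bosonization.mul ∘ₗ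
      TensorProduct.map (TensorProduct.mk k R H 1) ((TensorProduct.mk k R H).flip 1 ∘ₗ
        𝓡.act ∘ₗ (TensorProduct.mk k H R).flip s ∘ₗ S.symm.toLinearMap) ∘ₗ
      (TensorProduct.comm k H H).toLinearMap
    have hG0 : ∀ t : H ⊗[k] H, M.act (G t ⊗ₜ w) = 0 := by
      intro t
      induction t with
      | zero => simp only [map_zero, TensorProduct.zero_tmul]
      | add x y hx hy => rw [map_add, TensorProduct.add_tmul, map_add, hx, hy, add_zero]
      | tmul x y =>
        have : G (x ⊗ₜ y) = 𝓡.bosonization.mul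
          ((1 ⊗ₜ y) ⊗ₜ (𝓡.act (S.symm x ⊗ₜ s) ⊗ₜ 1)) := rfl
        rw [this, h.mul_act, hw _ ((hℛ.isYDSub j).act_mem _ s hr), TensorProduct.tmul_zero,
          map_zero]
    have hG : G (Coalgebra.comul g) = s ⊗ₜ g := by
      -- `L (x ⊗ (y₁ ⊗ y₂)) = y₁ S⁻¹(x) • s # y₂`
      let L : H ⊗[k] (H ⊗[k] H) →ₗ[k] R ⊗[k] H :=
        (𝓡.act ∘ₗ (TensorProduct.mk k H R).flip s ∘ₗ LinearMap.mul' k H ∘ₗ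
          (TensorProduct.comm k H H).toLinearMap ∘ₗ S.symm.toLinearMap.rTensor H).rTensor H ∘ₗ
        (TensorProduct.assoc k H H H).symm.toLinearMap
      have h1 : ∀ t : H ⊗[k] H, G t = L ((Coalgebra.comul (R := k) (A := H)).lTensor H t) := by
        intro t
        induction t with
        | zero => simp only [map_zero]
        | add x y hx hy => simp only [map_add, hx, hy]
        | tmul x y =>
          have : G (x ⊗ₜ y) = 𝓡.bosonization.mul
            ((1 ⊗ₜ y) ⊗ₜ (𝓡.act (S.symm x ⊗ₜ s) ⊗ₜ 1)) := rfl
          rw [this, bosonization_mul_tmul, LinearMap.lTensor_tmul]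
          generalize Coalgebra.comul (R := k) y = z
          induction z with
          | zero => simp only [map_zero, TensorProduct.tmul_zero]
          | add x y hx hy => simp only [map_add, TensorProduct.tmul_add, hx, hy]
          | tmul y₁ y₂ => simp [L, act_mul_left]
      have h2 : ∀ t : H ⊗[k] H, L (TensorProduct.assoc k H H H
          ((Coalgebra.comul (R := k) (A := H)).rTensor H t)) =
          s ⊗ₜ TensorProduct.lid k H ((Coalgebra.counit (R := k) (A := H)).rTensor H t) := by
        intro t
        induction t with
        | zero => simp only [map_zero, TensorProduct.tmul_zero]
        | add x y hx hy => simp only [map_add, TensorProduct.tmul_add, hx, hy]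
        | tmul x y =>
          simp only [L, LinearMap.comp_apply, LinearEquiv.coe_coe, LinearEquiv.symm_apply_apply,
            LinearMap.rTensor_tmul, hσ, LinearMap.flip_apply, TensorProduct.mk_apply,
            TensorProduct.lid_tmul, Algebra.algebraMap_eq_smul_one, ← TensorProduct.smul_tmul',
            map_smul, act_one_left, TensorProduct.tmul_smul]
      rw [h1, ← Coalgebra.coassoc_apply, h2, Coalgebra.rTensor_counit_comul]
      simp
    rw [← hG, hG0]

variable (k H R) in
/-- The map `ϑ : R # H → R`, `r # h ↦ r ε(h)`. -/
noncomputable def theta : R ⊗[k] H →ₗ[k] R :=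
  (TensorProduct.rid k R).toLinearMap ∘ₗ LinearMap.lTensor R (Coalgebra.counit : H →ₗ[k] k)

variable (k H R) in
/-- The map `π : R # H → H`, `r # h ↦ ε(r) h`. -/
noncomputable def piH : R ⊗[k] H →ₗ[k] H :=
  (TensorProduct.lid k H).toLinearMap ∘ₗ LinearMap.rTensor H (Coalgebra.counit : R →ₗ[k] k)

/-- `(ϑ ⊗ π) Δ = id`. -/
theorem map_theta_piH_comul (a : R ⊗[k] H) :
    TensorProduct.map (theta k H R) (piH k H R) (𝓡.bosonization.comul a) = a := by
  have key : ∀ (t : R ⊗[k] R) (p : H ⊗[k] H),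
      TensorProduct.map (theta k H R) (piH k H R) (cosmash 𝓡.toActCoact (t ⊗ₜ p)) =
      TensorProduct.rid k R ((Coalgebra.counit (R := k) (A := R)).lTensor R t) ⊗ₜ
        TensorProduct.lid k H ((Coalgebra.counit (R := k) (A := H)).rTensor H p) := by
    intro t p
    induction t with
    | zero => simp only [map_zero, TensorProduct.zero_tmul]
    | add x y hx hy => simp only [TensorProduct.add_tmul, map_add, hx, hy]
    | tmul r₁ r₂ =>
    induction p with
    | zero => simp only [map_zero, TensorProduct.tmul_zero]
    | add x y hx hy => simp only [TensorProduct.tmul_add, map_add, hx, hy]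
    | tmul h₁ h₂ =>
      rw [cosmash_tmul]
      have : ∀ x : H ⊗[k] R, TensorProduct.map (theta k H R) (piH k H R)
          (TensorProduct.map (TensorProduct.mk k R H r₁ ∘ₗ LinearMap.mulRight k h₁)
            ((TensorProduct.mk k R H).flip h₂) x) =
          (Coalgebra.counit (R := k) (TensorProduct.rid k H
            ((Coalgebra.counit (R := k) (A := R)).lTensor H x)) *
              Coalgebra.counit (R := k) h₁) • (r₁ ⊗ₜ h₂) := by
        intro x
        induction x with
        | zero => simp
        | add x y hx hy => simp only [map_add, hx, hy, add_mul, add_smul]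
        | tmul c u =>
          simp only [theta, piH, TensorProduct.map_tmul, LinearMap.comp_apply,
            LinearMap.mulRight_apply, TensorProduct.mk_apply, LinearMap.flip_apply,
            LinearEquiv.coe_coe, LinearMap.lTensor_tmul, LinearMap.rTensor_tmul,
            TensorProduct.rid_tmul, TensorProduct.lid_tmul, Bialgebra.counit_mul, map_smul,
            TensorProduct.smul_tmul_smul, smul_eq_mul]
          congr 1
          ring
      rw [this, lTensor_counit_coact]
      simp only [LinearMap.lTensor_tmul, LinearMap.rTensor_tmul, TensorProduct.rid_tmul,
        TensorProduct.lid_tmul, map_smul, Bialgebra.counit_one, smul_eq_mul, mul_one,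
        TensorProduct.smul_tmul_smul]
  induction a with
  | zero => simp only [map_zero]
  | add x y hx hy => simp only [map_add, hx, hy]
  | tmul r h =>
    rw [bosonization_comul_tmul, key, Coalgebra.lTensor_counit_comul,
      Coalgebra.rTensor_counit_comul]
    simp

omit [Coalgebra k R] in
theorem coactR_eq : coactR M = (theta k H R).rTensor W ∘ₗ M.coact := rfl

/-- The coaction of `R # H` is recovered from `δ^R` as `(id ⊗ (π ⊗ id) δ) δ^R`. -/
theorem assoc_coact (h : IsYD 𝓡.bosonization M) (w : W) :
    TensorProduct.assoc k R H W (M.coact w) =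
      ((piH k H R).rTensor W ∘ₗ M.coact).lTensor R (coactR M w) := by
  have h1 : ∀ x : (R ⊗[k] H) ⊗[k] W,
      ((piH k H R).rTensor W ∘ₗ M.coact).lTensor R ((theta k H R).rTensor W x) =
      TensorProduct.map (theta k H R) ((piH k H R).rTensor W)
        (M.coact.lTensor (R ⊗[k] H) x) := fun x => by
    induction x with
    | zero => simp only [map_zero]
    | add x y hx hy => simp only [map_add, hx, hy]
    | tmul a v => simp
  have h2 : ∀ x : (R ⊗[k] H) ⊗[k] W, TensorProduct.map (theta k H R) ((piH k H R).rTensor W)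
        (TensorProduct.assoc k _ _ W (𝓡.bosonization.comul.rTensor W x)) =
      TensorProduct.assoc k R H W x := fun x => by
    induction x with
    | zero => simp only [map_zero]
    | add x y hx hy => simp only [map_add, hx, hy]
    | tmul a v =>
      have h3 : ∀ t : (R ⊗[k] H) ⊗[k] (R ⊗[k] H),
          TensorProduct.map (theta k H R) ((piH k H R).rTensor W)
            (TensorProduct.assoc k _ _ W (t ⊗ₜ v)) =
          TensorProduct.assoc k R H W
            (TensorProduct.map (theta k H R) (piH k H R) t ⊗ₜ v) := fun t => by
        induction t with
        | zero => simp only [map_zero, TensorProduct.zero_tmul]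
        | add x y hx hy => simp only [map_add, TensorProduct.add_tmul, hx, hy]
        | tmul a b => simp
      rw [LinearMap.rTensor_tmul, h3, map_theta_piH_comul]
  rw [coactR_eq, LinearMap.comp_apply, h1, ← h.coassoc, h2]

theorem rTensor_comp_coactR_eq_zero_iff (h : IsYD 𝓡.bosonization M) (j : ℕ) (w : W) :
    (comp ℛ j).rTensor W (coactR M w) = 0 ↔
      ((comp ℛ j).rTensor H).rTensor W (M.coact w) = 0 := by
  constructor
  · intro h0
    apply (TensorProduct.assoc k R H W).injective
    have h1 : ∀ x : (R ⊗[k] H) ⊗[k] W,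
        TensorProduct.assoc k R H W (((comp ℛ j).rTensor H).rTensor W x) =
        (comp ℛ j).rTensor (H ⊗[k] W) (TensorProduct.assoc k R H W x) := fun x => by
      induction x with
      | zero => simp only [map_zero]
      | add x y hx hy => simp only [map_add, hx, hy]
      | tmul a v =>
        induction a with
        | zero => simp only [map_zero, TensorProduct.zero_tmul]
        | add x y hx hy => simp only [map_add, TensorProduct.add_tmul, hx, hy]
        | tmul r g => simp
    rw [h1, assoc_coact h, ← LinearMap.comp_apply, LinearMap.rTensor_comp_lTensor,
      ← LinearMap.lTensor_comp_rTensor, LinearMap.comp_apply, h0, map_zero, map_zero]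
  · intro h0
    have h1 : comp ℛ j ∘ₗ theta k H R = theta k H R ∘ₗ (comp ℛ j).rTensor H := by
      ext r g
      simp [theta]
    rw [coactR_eq, LinearMap.comp_apply, ← LinearMap.rTensor_comp_apply, h1,
      LinearMap.rTensor_comp_apply, h0, map_zero]

theorem mem_Fdelta_iff (h : IsYD 𝓡.bosonization M) (n : ℕ) (w : W) :
    w ∈ Fdelta ℛ M n ↔ ∀ j, n < j → ((comp ℛ j).rTensor H).rTensor W (M.coact w) = 0 := by
  rw [Fdelta, Submodule.mem_comap, mem_tens_biSup_iff]
  simp only [Set.mem_Iic, not_le, rTensor_comp_coactR_eq_zero_iff h]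

theorem mem_Fmu_iff (hS : Function.Bijective (HopfAlgebra.antipode k : H →ₗ[k] H))
    (hℛ : IsGradedYDHopfAlgebra 𝓡 ℛ) (h : IsYD 𝓡.bosonization M) (n : ℕ) (w : W) :
    w ∈ Fmu ℛ M n ↔ ∀ j, n < j → ∀ a, M.act ((comp ℛ j).rTensor H a ⊗ₜ w) = 0 := by
  constructor
  · intro hw j hj a
    exact act_eq_zero_of_left hS hℛ h (hw j hj) a
  · intro hw j hj r hr
    have := hw j hj (r ⊗ₜ 1)
    rwa [LinearMap.rTensor_tmul, comp_of_mem hr] at this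

/-- Local finiteness forces `A(j)` to kill a given homogeneous element for all large `j`. -/
theorem exists_act_eq_zero (hS : Function.Bijective (HopfAlgebra.antipode k : H →ₗ[k] H))
    (hℛ : IsGradedYDHopfAlgebra 𝓡 ℛ) (h : IsGradedYD 𝓡 ℛ M 𝒲) (hlf : IsLocallyFinite M)
    {m : ℤ} {w : W} (hw : w ∈ 𝒲 m) :
    ∃ b : ℕ, ∀ j, b < j → ∀ a, M.act ((comp ℛ j).rTensor H a ⊗ₜ w) = 0 := by
  obtain ⟨U, hU, hwU, hRU⟩ := hlf w
  classical
  -- a finite-dimensional subspace meets only finitely many homogeneous components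
  obtain ⟨s, hs⟩ : ∃ s : Finset ℤ, ∀ i ∉ s, ∀ u ∈ U, comp 𝒲 i u = 0 := by
    obtain ⟨T, rfl⟩ := (Submodule.fg_iff_finiteDimensional U).2 hU
    choose s hs using (isComponentFamily_comp 𝒲).complete
    refine ⟨T.biUnion s, fun i hi u hu => ?_⟩
    have : Submodule.span k (T : Set W) ≤ LinearMap.ker (comp 𝒲 i) :=
      Submodule.span_le.2 fun t ht => (isComponentFamily_comp 𝒲).eq_zero_of_notMem (hs t)
        fun his => hi (Finset.mem_biUnion.2 ⟨t, ht, his⟩)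
    exact this hu
  refine ⟨s.sup fun i => (i - m).toNat, fun j hj => act_eq_zero_of_left hS hℛ h.isYD ?_⟩
  intro r hr
  have hmem := h.act_mem j m (r ⊗ₜ 1) (tmul_mem_tens hr trivial) w hw
  rw [← comp_of_mem hmem]
  refine hs _ (fun his => ?_) _ (hRU r w hwU)
  have := Finset.le_sup (f := fun i : ℤ => (i - m).toNat) his
  omega

end Modules

/-! ### Irreducible graded Yetter-Drinfeld modules -/

section Irreducible

variable {k H R W : Type*} [Field k] [Ring H] [HopfAlgebra k H] [Ring R] [Algebra k R]
  [Coalgebra k R] {𝓡 : YDHopfAlgebra k H R} {ℛ : ℕ → Submodule k R} [DirectSum.Decomposition ℛ]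
  [AddCommGroup W] [Module k W] {M : ActCoact k (R ⊗[k] H) W} {𝒲 : ℤ → Submodule k W}
  [DirectSum.Decomposition 𝒲]

omit [DirectSum.Decomposition ℛ] in
theorem IsIrreducibleGradedYD.eq_bot_or_top_of_comp_mem (hW : IsIrreducibleGradedYD 𝓡 ℛ M 𝒲)
    (N : Submodule k W) (hN : IsYDSub M N) (hgr : ∀ i, ∀ v ∈ N, comp 𝒲 i v ∈ N) :
    N = ⊥ ∨ N = ⊤ :=
  hW.eq_bot_or_top N hN (eq_iSup_inf_of_comp_mem 𝒲 hgr)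

theorem exists_comp_ne_zero [Nontrivial W] (𝒲 : ℤ → Submodule k W)
    [DirectSum.Decomposition 𝒲] : ∃ m, ∃ w ∈ 𝒲 m, w ≠ 0 := by
  obtain ⟨w, hw⟩ := exists_ne (0 : W)
  by_contra! h0
  exact hw ((isComponentFamily_comp 𝒲).eq_zero fun m => h0 m _ (comp_mem 𝒲 m w))

variable (hℛ : IsGradedYDHopfAlgebra 𝓡 ℛ) (hW : IsIrreducibleGradedYD 𝓡 ℛ M 𝒲)
include hℛ hW

theorem eq_bot_of_lt_lowVec {m i : ℤ}
    (hm : lowVec M (fun n => (comp ℛ n).rTensor H) (comp 𝒲) m ≠ ⊥) (hi : i < m) : 𝒲 i = ⊥ :=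
  (Submodule.eq_bot_iff _).2 fun w hw => by
    rw [← comp_of_mem hw]
    exact (hW.isGradedYD.isGradedYDFamily hℛ).proj_eq_zero_of_lt_lowVec
      hW.eq_bot_or_top_of_comp_mem hm hi w

theorem eq_bot_of_gt_highVec {m i : ℤ}
    (hm : highVec M (fun n => (comp ℛ n).rTensor H) (comp 𝒲) m ≠ ⊥) (hi : m < i) : 𝒲 i = ⊥ :=
  (Submodule.eq_bot_iff _).2 fun w hw => by
    rw [← comp_of_mem hw]
    exact (hW.isGradedYD.isGradedYDFamily hℛ).proj_eq_zero_of_gt_highVec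
      hW.eq_bot_or_top_of_comp_mem (bosonization_isLeftHopf 𝓡) hm hi w

omit hℛ hW [Coalgebra k R] in
theorem ne_bot_of_lowVec {m : ℤ}
    (hm : lowVec M (fun n => (comp ℛ n).rTensor H) (comp 𝒲) m ≠ ⊥) : 𝒲 m ≠ ⊥ := fun h0 =>
  hm ((Submodule.eq_bot_iff _).2 fun _ hw => (Submodule.mem_bot k).1
    (h0 ▸ comp_eq_self_iff.1 hw.1))

omit hℛ hW [Coalgebra k R] in
theorem ne_bot_of_highVec {m : ℤ}
    (hm : highVec M (fun n => (comp ℛ n).rTensor H) (comp 𝒲) m ≠ ⊥) : 𝒲 m ≠ ⊥ := fun h0 =>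
  hm ((Submodule.eq_bot_iff _).2 fun _ hw => (Submodule.mem_bot k).1
    (h0 ▸ comp_eq_self_iff.1 hw.1))

theorem exists_isDegreeRange (hS : Function.Bijective (HopfAlgebra.antipode k : H →ₗ[k] H))
    (hlf : IsLocallyFinite M) : ∃ n₀ n₁ : ℤ, IsDegreeRange 𝒲 n₀ n₁ := by
  have hF := hW.isGradedYD.isGradedYDFamily hℛ
  have := hW.nontrivial
  obtain ⟨m, w, hw, hw0⟩ := exists_comp_ne_zero 𝒲
  obtain ⟨a, -, ha⟩ := hF.exists_lowVec_ne_bot (comp_of_mem hw) hw0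
  obtain ⟨b, hb⟩ := exists_act_eq_zero hS hℛ hW.isGradedYD hlf hw
  obtain ⟨c, -, hc⟩ := hF.exists_highVec_ne_bot (comp_of_mem hw) hw0 hb
  refine ⟨m - a, m + c, by omega, fun i hi => ?_, ne_bot_of_lowVec ha, ne_bot_of_highVec hc⟩
  rw [Set.mem_Icc, not_and_or, not_le, not_le] at hi
  rcases hi with hi | hi
  · exact eq_bot_of_lt_lowVec hℛ hW ha hi
  · exact eq_bot_of_gt_highVec hℛ hW hc hi

variable {n₀ n₁ : ℤ} (hn : IsDegreeRange 𝒲 n₀ n₁)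
include hn

omit hℛ hW in
theorem comp_eq_zero_of_notMem {i : ℤ} (hi : i ∉ Set.Icc n₀ n₁) (w : W) : comp 𝒲 i w = 0 :=
  (Submodule.mem_bot k).1 (hn.eq_bot i hi ▸ comp_mem 𝒲 i w)

theorem eq_of_lowVec_ne_bot {m : ℤ}
    (hm : lowVec M (fun n => (comp ℛ n).rTensor H) (comp 𝒲) m ≠ ⊥) : m = n₀ := by
  rcases lt_trichotomy m n₀ with h | h | h
  · exact absurd (hn.eq_bot m fun hm => not_lt.2 hm.1 h) (ne_bot_of_lowVec hm)
  · exact h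
  · exact absurd (eq_bot_of_lt_lowVec hℛ hW hm h) hn.low_ne_bot

theorem eq_of_highVec_ne_bot {m : ℤ}
    (hm : highVec M (fun n => (comp ℛ n).rTensor H) (comp 𝒲) m ≠ ⊥) : m = n₁ := by
  rcases lt_trichotomy m n₁ with h | h | h
  · exact absurd (eq_bot_of_gt_highVec hℛ hW hm h) hn.high_ne_bot
  · exact h
  · exact absurd (hn.eq_bot m fun hm => not_lt.2 hm.2 h) (ne_bot_of_highVec hm)

theorem Fdelta_eq (n : ℕ) : Fdelta ℛ M n = ⨆ i ∈ Set.Icc n₀ (n₀ + n), 𝒲 i := by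
  have hF := hW.isGradedYD.isGradedYDFamily hℛ
  ext w
  rw [mem_Fdelta_iff hW.isGradedYD.isYD, mem_biSup_iff]
  constructor
  · intro hw i hi
    by_contra h0
    -- the component of degree `i` of `w` lies in the filtration step as well
    have hwi : ∀ j, n < j → ((comp ℛ j).rTensor H).rTensor W (M.coact (comp 𝒲 i w)) = 0 := by
      intro j hj
      have h1 := hF.coact j (i - j) w
      rw [show (j : ℤ) + (i - j) = i by ring] at h1
      rw [← h1, ← LinearMap.lTensor_comp_rTensor, LinearMap.comp_apply, hw j hj, map_zero]
    obtain ⟨a, ha, hlow⟩ := hF.exists_lowVec_ne_bot (comp_of_mem (comp_mem 𝒲 i w)) h0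
    have h2 := eq_of_lowVec_ne_bot hℛ hW hn hlow
    have h3 : a ≤ n := by
      by_contra! h4
      exact ha (hwi a h4)
    exact hi ⟨by omega, by omega⟩
  · intro hw j hj
    refine (isComponentFamily_comp 𝒲).mem
      (N := LinearMap.ker (((comp ℛ j).rTensor H).rTensor W ∘ₗ M.coact)) fun i => ?_
    by_cases hi : i ∈ Set.Icc n₀ (n₀ + n)
    · have h1 := hF.coact j (i - j) w
      rw [show (j : ℤ) + (i - j) = i by ring] at h1
      have h2 : comp 𝒲 (i - j) = 0 := LinearMap.ext fun v =>
        comp_eq_zero_of_notMem hn (fun h => by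
          have := h.1
          have := hi.2
          omega) v
      rw [LinearMap.mem_ker, LinearMap.comp_apply, ← h1, h2, TensorProduct.map_zero_right,
        LinearMap.zero_apply]
    · rw [hw i hi]
      exact Submodule.zero_mem _

theorem Fmu_eq (hS : Function.Bijective (HopfAlgebra.antipode k : H →ₗ[k] H)) (n : ℕ) :
    Fmu ℛ M n = ⨆ i ∈ Set.Icc (n₁ - n) n₁, 𝒲 i := by
  have hF := hW.isGradedYD.isGradedYDFamily hℛ
  ext w
  rw [mem_Fmu_iff hS hℛ hW.isGradedYD.isYD, mem_biSup_iff]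
  constructor
  · intro hw i hi
    by_contra h0
    obtain ⟨a, ha, hhigh⟩ := hF.exists_highVec_ne_bot (comp_of_mem (comp_mem 𝒲 i w)) h0
      (b := n) fun j hj a => by rw [← hF.act, hw j hj, map_zero]
    have h2 := eq_of_highVec_ne_bot hℛ hW hn hhigh
    exact hi ⟨by omega, by omega⟩
  · intro hw j hj a
    refine (isComponentFamily_comp 𝒲).mem
      (N := LinearMap.ker (M.act ∘ₗ TensorProduct.mk k _ W ((comp ℛ j).rTensor H a))) fun i => ?_
    by_cases hi : i ∈ Set.Icc (n₁ - n) n₁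
    · rw [LinearMap.mem_ker, LinearMap.comp_apply, TensorProduct.mk_apply, ← hF.act]
      refine comp_eq_zero_of_notMem hn (fun h => ?_) _
      have := h.2
      have := hi.1
      omega
    · rw [hw i hi]
      exact Submodule.zero_mem _

theorem isIrreducibleYD_component_low :
    IsIrreducibleYD (zeroBosonization 𝓡 ℛ) (component ℛ M 𝒲 n₀) where
  isYD := isYD_component hℛ hW.isGradedYD n₀
  nontrivial := (Submodule.nontrivial_iff_ne_bot).2 hn.low_ne_bot
  eq_bot_or_top N hN := by
    have hF := hW.isGradedYD.isGradedYDFamily hℛ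
    rw [or_iff_not_imp_left]
    intro hN0
    have hdeg : ∀ v ∈ N.map (𝒲 n₀).subtype, comp 𝒲 n₀ v = v := by
      rintro _ ⟨v, -, rfl⟩
      exact comp_of_mem v.2
    have hbot : N.map (𝒲 n₀).subtype ≠ ⊥ := fun h0 => hN0 <|
      Submodule.map_injective_of_injective (𝒲 n₀).injective_subtype
        (h0.trans (Submodule.map_bot _).symm)
    have hco : ∀ v ∈ N.map (𝒲 n₀).subtype,
        M.coact v ∈ tens (⊤ : Submodule k (R ⊗[k] H)) (N.map (𝒲 n₀).subtype) := fun v hv => by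
      refine mem_tens_top_iff.2 (hF.slice_mem fun n f => ?_)
      rcases Nat.eq_zero_or_pos n with rfl | hpos
      · exact slice_mem_map_subtype hℛ hW.isGradedYD hN f v hv
      · -- below `n₀` there is nothing
        have h1 := hF.proj_slice (n := n) (i := n₀ - n) f (hdeg v hv)
        rw [if_pos (by ring), comp_eq_zero_of_notMem hn (fun h => by
          have := h.1
          omega)] at h1
        rw [← h1]
        exact Submodule.zero_mem _
    refine eq_top_iff.2 fun v _ => ?_
    obtain ⟨u, hu, huv⟩ := hF.proj_mem_of_subcomodule hW.eq_bot_or_top_of_comp_mem hdeg hbot hco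
      (act_mem_map_subtype hℛ hW.isGradedYD hN) v
    rw [comp_of_mem v.2] at huv
    rwa [← Subtype.ext huv]

theorem isIrreducibleYD_component_high :
    IsIrreducibleYD (zeroBosonization 𝓡 ℛ) (component ℛ M 𝒲 n₁) where
  isYD := isYD_component hℛ hW.isGradedYD n₁
  nontrivial := (Submodule.nontrivial_iff_ne_bot).2 hn.high_ne_bot
  eq_bot_or_top N hN := by
    have hF := hW.isGradedYD.isGradedYDFamily hℛ
    rw [or_iff_not_imp_left]
    intro hN0
    have hdeg : ∀ v ∈ N.map (𝒲 n₁).subtype, comp 𝒲 n₁ v = v := by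
      rintro _ ⟨v, -, rfl⟩
      exact comp_of_mem v.2
    have hbot : N.map (𝒲 n₁).subtype ≠ ⊥ := fun h0 => hN0 <|
      Submodule.map_injective_of_injective (𝒲 n₁).injective_subtype
        (h0.trans (Submodule.map_bot _).symm)
    have hact : ∀ (a : R ⊗[k] H), ∀ v ∈ N.map (𝒲 n₁).subtype,
        M.act (a ⊗ₜ v) ∈ N.map (𝒲 n₁).subtype := fun a v hv => by
      refine hF.act_mem (fun n a => ?_) a
      rcases Nat.eq_zero_or_pos n with rfl | hpos
      · exact act_mem_map_subtype hℛ hW.isGradedYD hN a v hv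
      · -- above `n₁` there is nothing
        have h1 := hF.proj_act (n := n) (i := n + n₁) a (hdeg v hv)
        rw [if_pos rfl, comp_eq_zero_of_notMem hn (fun h => by
          have := h.2
          omega)] at h1
        rw [← h1]
        exact Submodule.zero_mem _
    refine eq_top_iff.2 fun v _ => ?_
    obtain ⟨u, hu, huv⟩ := hF.proj_mem_of_submodule hW.eq_bot_or_top_of_comp_mem
      (bosonization_isLeftHopf 𝓡) hdeg hbot hact (slice_mem_map_subtype hℛ hW.isGradedYD hN) v
    rw [comp_of_mem v.2] at huv
    rwa [← Subtype.ext huv]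

end Irreducible

end BosonizationYD

theorem mainTheorem11 {k H R W : Type*} [Field k] [Ring H] [HopfAlgebra k H]
    (hS : Function.Bijective (HopfAlgebra.antipode k : H →ₗ[k] H))
    [Ring R] [Algebra k R] [Coalgebra k R] (𝓡 : BosonizationYD.YDHopfAlgebra k H R)
    (ℛ : ℕ → Submodule k R) [DirectSum.Decomposition ℛ]
    (hℛ : BosonizationYD.IsGradedYDHopfAlgebra 𝓡 ℛ)
    (hfin : ∀ n, FiniteDimensional k (ℛ n))
    [AddCommGroup W] [Module k W] (M : BosonizationYD.ActCoact k (R ⊗[k] H) W)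
    (𝒲 : ℤ → Submodule k W) [DirectSum.Decomposition 𝒲]
    (hW : BosonizationYD.IsIrreducibleGradedYD 𝓡 ℛ M 𝒲)
    (hlf : BosonizationYD.IsLocallyFinite M) :
    (∃ n₀ n₁ : ℤ, BosonizationYD.IsDegreeRange 𝒲 n₀ n₁) ∧
    ∀ n₀ n₁ : ℤ, BosonizationYD.IsDegreeRange 𝒲 n₀ n₁ →
      (∀ n : ℕ,
        BosonizationYD.Fdelta ℛ M n = (⨆ i ∈ Set.Icc n₀ (n₀ + n), 𝒲 i) ∧
        BosonizationYD.Fmu ℛ M n = (⨆ i ∈ Set.Icc (n₁ - n) n₁, 𝒲 i)) ∧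
      BosonizationYD.IsIrreducibleYD (BosonizationYD.zeroBosonization 𝓡 ℛ)
        (BosonizationYD.component ℛ M 𝒲 n₀) ∧
      BosonizationYD.IsIrreducibleYD (BosonizationYD.zeroBosonization 𝓡 ℛ)
        (BosonizationYD.component ℛ M 𝒲 n₁) := by
  refine ⟨BosonizationYD.exists_isDegreeRange hℛ hW hS hlf, fun n₀ n₁ hn => ⟨fun n => ?_, ?_, ?_⟩⟩
  · exact ⟨BosonizationYD.Fdelta_eq hℛ hW hn n, BosonizationYD.Fmu_eq hℛ hW hn hS n⟩
  · exact BosonizationYD.isIrreducibleYD_component_low hℛ hW hn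
  · exact BosonizationYD.isIrreducibleYD_component_high hℛ hW hn
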